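/- **Model (randomized No-CD radio network).** The network is a connected undirected graph $G=(V,E)$ with $n=|V|$ vertices and maximum degree $\Delta$. Every vertex is a device, and all devices are identical. Communication proceeds in synchronized rounds with a common start and a global clock. In every round each device either stays idle, listens, or sends a message of arbitrary finite length (it cannot send and listen in the same round). A listening device $v$ receives a message exactly if precisely one neighbour of $v$ sends in that round, and then it receives the message of that neighbour; otherwise it hears silence (collisions are not distinguished from silence). Sending or idle devices get no feedback. Initially a device knows only $n$, $\Delta$, whether it is the source $s$, and the outcomes of its own private independent fair random bits; the topology of $G$ is unknown and there is no shared randomness. Local computation is free. The time of an algorithm is its number of rounds. The energy of a device is the number of rounds in which it sends or listens, and the energy of an execution is the maximum energy of a device. **Theorem.** There is an integer $k\ge 0$ such that for every integer $c\ge 0$ there are a real number $C$ and a randomized No-CD algorithm with the following properties. For every connected graph $G$ with $n\ge 1$ vertices and every source $s\in V(G)$, the algorithm always terminates within $C\,n^{3/2}(1+\log n)^k=\tilde O(n^{1.5})$ rounds, in every execution it has energy at most $C\sqrt n\,(1+\log n)^k=\tilde O(\sqrt n)$, and with probability at least $1-n^{-c}$ every vertex $v$ outputs its distance $\operatorname{dist}_G(v,s)$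 at the end of the execution. -/

import Mathlib

open MeasureTheory

namespace RadioNetwork

/-- What a device does in one round: stay idle, listen to the channel, or send a message.
A message is an arbitrary finite bit string (there is no bound on its length), coded as a
natural number. Devices are half-duplex: they never send and listen in the same round. -/
inductive Action where
  | idle : Action
  | listen : Action
  | send (m : ℕ) : Action
  deriving DecidableEq

/-- The transmitted message, if the action is a transmission. -/
def Action.payload : Action → Option ℕ
  | .idle => none
  | .listen => none
  | .send m => some m

/-- Channel feedback without collision detection. If device `v` listens and exactly one of its
neighbours transmits, then `v` receives the message of that neighbour. If `v` listens and the number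
of transmitting neighbours is not one, then `v` hears silence, which is `none`. A device that sends
or is idle gets no feedback, also written `none` (a device knows its own action). -/
noncomputable def feedback {V : Type*} (G : SimpleGraph V) (a : V → Action) (v : V) : Option ℕ :=
  open Classical in
  if a v = Action.listen then
    if h : ∃! u, G.Adj v u ∧ (a u).payload.isSome then (a h.choose).payload else none
  else none

/-- A randomized protocol, run by every device of the network. The devices are anonymous, start
simultaneously, have a common clock, and have unlimited local computing power and memory.
* `rounds` is the number of communication rounds;
* `coins` is the number of private random bits of each device (any finite number);
* `init b r` is the initial state of a device, where `b` tells the device whether it is the source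
  and `r` is the outcome of its private random bits;
* `act t q` is the action in round `t` of a device in state `q`;
* `step t q f` is the new state, after round `t`, of a device that was in state `q` and
  got the feedback `f` from the channel;
* `output q` is the result that a device in the final state `q` announces. -/
structure Protocol where
  rounds : ℕ
  coins : ℕ
  State : Type
  init : Bool → (Fin coins → Bool) → State
  act : ℕ → State → Action
  step : ℕ → State → Option ℕ → State
  output : State → ℕ

namespace Protocol

variable (P : Protocol) {V : Type*} [DecidableEq V] (G : SimpleGraph V) (s : V)
  (ω : V → Fin P.coins → Bool)

/-- The states of all devices after `t` rounds, on the network `G` with source `s`, where `ω v` is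
the outcome of the private random bits of the device `v`. -/
noncomputable def state : ℕ → V → P.State
  | 0 => fun v => P.init (decide (v = s)) (ω v)
  | t + 1 => fun v =>
      P.step t (state t v) (feedback G (fun u => P.act t (state t u)) v)

/-- The action of the device `v` in round `t`. -/
noncomputable def action (t : ℕ) (v : V) : Action :=
  P.act t (P.state G s ω t v)

/-- The energy cost of the device `v`: the number of rounds in which it sends or listens. -/
noncomputable def deviceEnergy (v : V) : ℕ :=
  ((Finset.range P.rounds).filter fun t => P.action G s ω t v ≠ Action.idle).card

/-- The energy cost of an execution: the maximum of the energy costs of the devices. -/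
noncomputable def energy [Fintype V] : ℕ :=
  Finset.univ.sup fun v => P.deviceEnergy G s ω v

/-- The output of the device `v` at the end of the execution. -/
noncomputable def result (v : V) : ℕ :=
  P.output (P.state G s ω P.rounds v)

/-- The law of the private random bits of all devices: independent fair coin flips, independent
between the devices. -/
noncomputable def law (V : Type*) [Fintype V] : Measure (V → Fin P.coins → Bool) :=
  Measure.pi fun _ => Measure.pi fun _ => (PMF.uniformOfFintype Bool).toMeasure

end Protocol

end RadioNetwork

/-! A breadth-first search from the source can have almost `n` levels, too many for a device to
listen through. Cut them into about `√n` stages of `r` levels. A device then needs only a rough idea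
of the stage in which its own level lies, and it gets this from random clusterings. Before each
stage, the devices at level `i * r` raise an alert, which climbs through the clusters to the centers
and descends again. A device is active in an alert only when the sweep passes its own level in the
cluster, so it pays O(1) steps per clustering and stage.

Two facts make the alerts useful. If the ball of radius `r` around `x` lies in one cluster of radius
at most `H`, an alert of `x` reaches the whole ball, hence whatever the search can reach from `x` in
this stage (`alerted_of_dist_le`). Conversely an alert travels at most `W = 4 * L * r`
(`exists_dist_le_of_flag`), so no device is alerted more than `4 * L` stages too early. Listening
for `4 * L + 1` stages from the first alert therefore suffices (`first_known_iff`) and is cheap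
(`card_active_le`).

All randomness rests on `le_prob_exists_unique`: independent trials of rate about `1 / |B|` single
out one member of `B`, lying in a given half `A ⊆ B`, with probability at least 1/16. For a set `B`
of sending neighbours, this resolves collisions. For two balls `A ⊆ B` around `x` whose radii differ
by `2 * r`, it yields a center nearest to every point of the `r`-ball. Suitable balls exist because
the volume cannot double at `L` scales when `n < 2 ^ L`.

Who sends depends on past receptions, hence on past coins. The failure bound is therefore taken
along the failure-free execution `ideal`, which is determined by the centers alone; the real
execution agrees with it as long as no step of it fails (`heard_receptions_iff`). -/

namespace RadioNetwork

/-! ### Distances in connected graphs -/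

section Distance

variable {V : Type*} {G : SimpleGraph V}

/-- `j` is the least index at which the predicate `g` holds. -/
def First (g : ℕ → Prop) (j : ℕ) : Prop := g j ∧ ∀ i < j, ¬ g i

theorem First.unique {g : ℕ → Prop} {i j : ℕ} (hi : First g i) (hj : First g j) : i = j := by
  rcases lt_trichotomy i j with h | h | h
  · exact (hj.2 i h hi.1).elim
  · exact h
  · exact (hi.2 j h hj.1).elim

theorem exists_first_le {g : ℕ → Prop} {j : ℕ} (h : g j) : ∃ i ≤ j, First g i := by
  classical
  exact ⟨Nat.find ⟨j, h⟩, Nat.find_min' _ h, Nat.find_spec ⟨j, h⟩, fun i hi => Nat.find_min _ hi⟩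

theorem First.congr {g g' : ℕ → Prop} {j : ℕ} (h : ∀ i ≤ j, (g i ↔ g' i)) :
    First g j ↔ First g' j := by
  unfold First
  rw [h j le_rfl]
  refine and_congr_right fun _ => forall₂_congr fun i hi => ?_
  rw [h i hi.le]

theorem exists_adj_dist_eq (hG : G.Connected) {u w : V} {k : ℕ} (h : G.dist u w = k + 1) :
    ∃ u', G.Adj u u' ∧ G.dist u' w = k := by
  obtain ⟨p, hp⟩ := hG.exists_walk_length_eq_dist u w
  cases p with
  | nil => simp at h
  | @cons _ v _ hadj q =>
    refine ⟨_, hadj, ?_⟩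
    rw [SimpleGraph.Walk.length_cons] at hp
    have h1 := SimpleGraph.dist_le q
    have h2 := SimpleGraph.dist_eq_one_iff_adj.2 hadj
    have h3 := hG.dist_triangle (u := u) (v := v) (w := w)
    omega

theorem exists_dist_eq_add (hG : G.Connected) {w : V} (a b : ℕ) {u : V}
    (h : G.dist u w = a + b) : ∃ x, G.dist x w = a ∧ G.dist u x = b := by
  induction b generalizing u with
  | zero => exact ⟨u, h, by simp⟩
  | succ b ih =>
    obtain ⟨u', hadj, hu'⟩ := exists_adj_dist_eq hG (k := a + b) h
    obtain ⟨x, hx, hux⟩ := ih hu'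
    refine ⟨x, hx, ?_⟩
    have h1 := hG.dist_triangle (u := u) (v := u') (w := x)
    have h2 := hG.dist_triangle (u := u) (v := x) (w := w)
    have h3 := SimpleGraph.dist_eq_one_iff_adj.2 hadj
    omega

theorem dist_le_succ_of_adj (hG : G.Connected) {u v : V} (h : G.Adj u v) (w : V) :
    G.dist u w ≤ G.dist v w + 1 := by
  have h1 := hG.dist_triangle (u := u) (v := v) (w := w)
  have h2 := SimpleGraph.dist_eq_one_iff_adj.2 h
  omega

/-- The distance from `v` to the nearest vertex of `Z` is `j`. -/
def Near (G : SimpleGraph V) (Z : V → Prop) (v : V) (j : ℕ) : Prop :=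
  (∃ z, Z z ∧ G.dist v z = j) ∧ ∀ z, Z z → j ≤ G.dist v z

theorem Near.unique {Z : V → Prop} {v : V} {i j : ℕ} (hi : Near G Z v i) (hj : Near G Z v j) :
    i = j := by
  obtain ⟨⟨z, hz, rfl⟩, h1⟩ := hi
  obtain ⟨⟨z', hz', rfl⟩, h2⟩ := hj
  exact le_antisymm (h1 _ hz') (h2 _ hz)

theorem exists_near_le {Z : V → Prop} {v z : V} (hz : Z z) : ∃ j ≤ G.dist v z, Near G Z v j := by
  obtain ⟨j, hj, ⟨z', hz', h1⟩, h2⟩ :=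
    exists_first_le (g := fun j => ∃ z, Z z ∧ G.dist v z = j) ⟨z, hz, rfl⟩
  refine ⟨j, hj, ⟨z', hz', h1⟩, fun z'' hz'' => ?_⟩
  by_contra! hlt
  exact h2 _ hlt ⟨z'', hz'', rfl⟩

theorem Near.exists_adj (hG : G.Connected) {Z : V → Prop} {v : V} {j : ℕ}
    (h : Near G Z v (j + 1)) : ∃ u, G.Adj v u ∧ Near G Z u j := by
  obtain ⟨⟨z, hz, hd⟩, hmin⟩ := h
  obtain ⟨u, hadj, hu⟩ := exists_adj_dist_eq hG hd
  refine ⟨u, hadj, ⟨z, hz, hu⟩, fun z' hz' => ?_⟩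
  have := hmin z' hz'
  have := dist_le_succ_of_adj hG hadj z'
  omega

theorem near_singleton {s v : V} {j : ℕ} : Near G (· = s) v j ↔ G.dist v s = j := by
  simp only [Near, exists_eq_left, forall_eq, and_iff_left_iff_imp]
  exact fun h => h.ge

/-- Breadth-first search is correct, if a vertex is only reached by a vertex that was reached in the
preceding step, and the vertices whose turn it is are indeed reached. -/
theorem first_iff_near (hG : G.Connected) {g : V → ℕ → Prop} {Z : V → Prop} {N : ℕ}
    (h0 : ∀ v, g v 0 ↔ Z v)
    (hs : ∀ j < N, ∀ v, g v (j + 1) → ∃ u, G.Adj v u ∧ First (g u) j)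
    (hc : ∀ j < N, (∀ i ≤ j, ∀ v, First (g v) i ↔ Near G Z v i) →
      ∀ v, Near G Z v (j + 1) → g v (j + 1)) :
    ∀ j ≤ N, ∀ v, First (g v) j ↔ Near G Z v j := by
  intro j
  induction j using Nat.strong_induction_on with
  | _ j ih =>
    intro hjN v
    cases j with
    | zero =>
      simp only [First, h0, Near]
      constructor
      · rintro ⟨h, -⟩
        exact ⟨⟨v, h, by simp⟩, by simp⟩
      · rintro ⟨⟨z, hz, hd⟩, -⟩
        rw [hG.dist_eq_zero_iff] at hd
        subst hd
        exact ⟨hz, by simp⟩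
    | succ j =>
      have ih' : ∀ i ≤ j, ∀ v, First (g v) i ↔ Near G Z v i :=
        fun i hi v => ih i (by omega) (by omega) v
      constructor
      · rintro ⟨hg, hnot⟩
        obtain ⟨u, hadj, hu⟩ := hs j (by omega) v hg
        rw [ih' j le_rfl] at hu
        obtain ⟨z, hz, hd⟩ := hu.1
        have hle := dist_le_succ_of_adj hG hadj z
        have hlb : ∀ z', Z z' → j + 1 ≤ G.dist v z' := by
          intro z' hz'
          -- A nearer point of `Z` would put `v` at a smaller level, where the induction hypothesis
          -- says it was already reached.
          by_contra! hlt
          obtain ⟨i, hi, hn⟩ := exists_near_le (G := G) (v := v) hz'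
          exact hnot i (by omega) ((ih' i (by omega) v).2 hn).1
        exact ⟨⟨z, hz, by have := hlb z hz; omega⟩, hlb⟩
      · intro hn
        refine ⟨hc j (by omega) ih' v hn, fun i hi hgi => ?_⟩
        obtain ⟨i', hi', hf⟩ := exists_first_le hgi
        have := hn.unique ((ih' i' (by omega) v).1 hf)
        omega

end Distance

/-! ### The algorithm on the level of local broadcasts

The algorithm proceeds in *steps*. In each step a device sends, listens or does nothing, and a
listening device learns whether at least one of its neighbours sends. The history `h` of a device
is the set of steps in which it heard something. The algorithm uses `B` random sets of centers.
* In stage `(0, κ)` with `κ < B`, every device learns its distance to the nearest center of the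
  `κ`-th set, by breadth-first search.
* In stage `(i + 1, κ)` with `κ < B`, the devices at distance `i * r` from the source alert their
  nearest centers of the `κ`-th set, and these alert all devices to which they are nearest.
* In stage `(i + 1, B)`, the devices that have been alerted recently continue the breadth-first
  search from the source from distance `i * r` to distance `(i + 1) * r`.
-/

/-- The parameters of the algorithm: the number `L` of sampling rates, the number `Q` of
repetitions for each sampling rate, and the number `r` of search steps in a stage. -/
structure Params where
  L : ℕ
  Q : ℕ
  r : ℕ

namespace Params

variable (p : Params)

/-- The number of sets of centers. -/
def B : ℕ := p.L * p.Q

/-- An upper bound on the radius of the clusters around the centers. -/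
def H : ℕ := 2 * p.r * p.L

/-- The number of steps in a stage. -/
def W : ℕ := 2 * p.H

/-- The number of steps of the algorithm. -/
def steps : ℕ := (p.r + 1) * (p.B + 1) * p.W

/-- The number of the `t`-th step in stage `(i, κ)`. -/
def enc (i κ t : ℕ) : ℕ := (i * (p.B + 1) + κ) * p.W + t

/-- The level whose devices send in the `t`-th step of an alerting stage. -/
def sweep (t : ℕ) : ℕ := (p.H - t) + (t - p.H)

variable (src : Prop) (ctr h : ℕ → Prop)

/-- The device is a center of the `κ`-th set, or heard something in step `j - 1` of the search
from these centers. -/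
def reached (κ : ℕ) : ℕ → Prop
  | 0 => ctr κ
  | j + 1 => h (p.enc 0 κ j)

/-- The device is the source, or heard something in step `D - 1` of the search from the source. -/
def known : ℕ → Prop
  | 0 => src
  | D + 1 => h (p.enc (D / p.r + 1) p.B (D % p.r))

/-- The device is at distance `i * r` from the source or was alerted before step `t` of stage
`(i + 1, κ)`. -/
def flag (i κ t : ℕ) : Prop :=
  First (p.known src h) (i * p.r) ∨ ∃ t' < t, h (p.enc (i + 1) κ t')

def alerted (i : ℕ) : Prop := ∃ κ < p.B, p.flag src h i κ p.W

/-- The device takes part in the `i`-th stage of the search from the source. -/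
def window (i : ℕ) : Prop :=
  (∃ i' ≤ i, p.alerted src h i') ∧ ∀ i' ≤ i, p.alerted src h i' → i ≤ i' + 4 * p.L

/-- With truncated subtraction, `sweep t` is `|H - t|`: the sending level falls from `H` to 0 and
rises again. Alerts carry no cluster identity and may leak into neighbouring clusters; this is
harmless, since only the distance they travel matters. -/
def sendsAt : ℕ → ℕ → ℕ → Prop
  | 0, κ, t => κ < p.B ∧ First (p.reached ctr h κ) t
  | i + 1, κ, t => (κ < p.B ∧ First (p.reached ctr h κ) (p.sweep t) ∧ p.flag src h i κ t) ∨
      (κ = p.B ∧ t < p.r ∧ First (p.known src h) (i * p.r + t))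

/-- In an alert a device listens one step before the sweep comes to its level. Listening throughout
is affordable in stage 0, which occurs only once. -/
def listensAt : ℕ → ℕ → ℕ → Prop
  | 0, κ, _ => κ < p.B
  | i + 1, κ, t => (κ < p.B ∧ First (p.reached ctr h κ) (p.sweep (t + 1))) ∨
      (κ = p.B ∧ t < p.r ∧ p.window src h i)

/-- The device sends in step `T`. -/
def sends (T : ℕ) : Prop :=
  p.sendsAt src ctr h (T / p.W / (p.B + 1)) (T / p.W % (p.B + 1)) (T % p.W)

/-- The device listens in step `T`, unless it sends. -/
def listens (T : ℕ) : Prop :=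
  p.listensAt src ctr h (T / p.W / (p.B + 1)) (T / p.W % (p.B + 1)) (T % p.W)

variable {p src ctr h}

theorem _root_.Nat.mul_add_div_of_lt {a b c : ℕ} (h : c < b) : (a * b + c) / b = a := by
  rw [mul_comm, Nat.mul_add_div (by omega), Nat.div_eq_of_lt h, add_zero]

theorem sends_enc {i κ t : ℕ} (hκ : κ ≤ p.B) (ht : t < p.W) :
    p.sends src ctr h (p.enc i κ t) ↔ p.sendsAt src ctr h i κ t := by
  rw [sends, enc, Nat.mul_add_div_of_lt ht, Nat.mul_add_div_of_lt (by omega),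
    Nat.mul_add_mod_of_lt ht, Nat.mul_add_mod_of_lt (by omega)]

theorem listens_enc {i κ t : ℕ} (hκ : κ ≤ p.B) (ht : t < p.W) :
    p.listens src ctr h (p.enc i κ t) ↔ p.listensAt src ctr h i κ t := by
  rw [listens, enc, Nat.mul_add_div_of_lt ht, Nat.mul_add_div_of_lt (by omega),
    Nat.mul_add_mod_of_lt ht, Nat.mul_add_mod_of_lt (by omega)]

theorem exists_enc_eq (hW : 0 < p.W) (T : ℕ) :
    ∃ i κ t, κ ≤ p.B ∧ t < p.W ∧ p.enc i κ t = T :=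
  ⟨T / p.W / (p.B + 1), T / p.W % (p.B + 1), T % p.W,
    Nat.lt_succ_iff.1 (Nat.mod_lt _ (by omega)), Nat.mod_lt _ hW, by
      rw [enc, mul_comm _ (p.B + 1), Nat.div_add_mod, mul_comm, Nat.div_add_mod]⟩

theorem enc_lt_enc {i κ t i' κ' t' : ℕ} (hκ : κ ≤ p.B) (ht : t < p.W)
    (hlt : i < i' ∨ i = i' ∧ (κ < κ' ∨ κ = κ' ∧ t < t')) : p.enc i κ t < p.enc i' κ' t' := by
  unfold enc
  have key : ∀ {a b : ℕ}, a < b → a * p.W + t < b * p.W + t' := fun {a b} hab => by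
    have := Nat.mul_le_mul_right p.W (Nat.succ_le_of_lt hab)
    rw [Nat.succ_mul] at this
    omega
  rcases hlt with h | ⟨rfl, h | ⟨rfl, h⟩⟩
  · apply key
    have := Nat.mul_le_mul_right (p.B + 1) (Nat.succ_le_of_lt h)
    rw [Nat.succ_mul] at this
    omega
  · exact key (by omega)
  · omega

theorem enc_lt_steps {i κ t : ℕ} (hi : i ≤ p.r) (hκ : κ ≤ p.B) (ht : t < p.W) :
    p.enc i κ t < p.steps := by
  have : p.enc i κ t < p.enc (p.r + 1) 0 0 := enc_lt_enc hκ ht (by omega)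
  simpa [enc, steps] using this

theorem sweep_le {t : ℕ} (ht : t ≤ p.W) : p.sweep t ≤ p.H := by
  simp only [sweep, W] at *
  omega

theorem r_le_W (hL : 0 < p.L) : p.r ≤ p.W := by
  simp only [W, H]
  nlinarith [Nat.zero_le p.r]

/-! #### A step depends only on what happened before -/

variable {h' : ℕ → Prop}

theorem reached_congr {T κ j : ℕ} (hT : ∀ t < T, (h t ↔ h' t))
    (hj : ∀ j' < j, p.enc 0 κ j' < T) : p.reached ctr h κ j ↔ p.reached ctr h' κ j := by
  cases j with
  | zero => rfl
  | succ j => exact hT _ (hj j (by omega))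

theorem first_reached_congr {T κ j : ℕ} (hT : ∀ t < T, (h t ↔ h' t))
    (hj : ∀ j' < j, p.enc 0 κ j' < T) :
    First (p.reached ctr h κ) j ↔ First (p.reached ctr h' κ) j :=
  First.congr fun _ hi => reached_congr hT fun _ hj' => hj _ (by omega)

/-- Division by `r` turns the order of levels into the lexicographic order of steps, so the lower
levels are settled before the current step. -/
theorem enc_search_lt (hL : 0 < p.L) {D i t : ℕ} (ht : t < p.r) (hD : D < i * p.r + t) :
    p.enc (D / p.r + 1) p.B (D % p.r) < p.enc (i + 1) p.B t := by
  have hm : D % p.r < p.r := Nat.mod_lt _ (by omega)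
  refine enc_lt_enc le_rfl (hm.trans_le (r_le_W hL)) ?_
  have h1 := Nat.div_add_mod D p.r
  rcases lt_trichotomy (D / p.r) i with hlt | heq | hgt
  · omega
  · rw [heq, mul_comm] at h1
    omega
  · have := Nat.mul_le_mul_left p.r (Nat.succ_le_of_lt hgt)
    rw [Nat.mul_succ, mul_comm] at this
    omega

theorem first_known_congr {T D : ℕ} (hT : ∀ t < T, (h t ↔ h' t))
    (hD : ∀ D' < D, p.enc (D' / p.r + 1) p.B (D' % p.r) < T) :
    First (p.known src h) D ↔ First (p.known src h') D :=
  First.congr fun i hi => by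
    cases i with
    | zero => rfl
    | succ i => exact hT _ (hD i (by omega))

theorem enc_search_lt_stage (hL : 0 < p.L) {D i κ t : ℕ} (hD : D < i * p.r) :
    p.enc (D / p.r + 1) p.B (D % p.r) < p.enc (i + 1) κ t := by
  have hr : 0 < p.r := by
    rcases Nat.eq_zero_or_pos p.r with h | h
    · simp [h] at hD
    · exact h
  refine enc_lt_enc le_rfl ((Nat.mod_lt _ hr).trans_le (r_le_W hL)) (Or.inl ?_)
  have := (Nat.div_lt_iff_lt_mul hr).2 hD
  omega

theorem flag_congr (hL : 0 < p.L) {T i κ t : ℕ} (hT : ∀ t < T, (h t ↔ h' t))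
    (ht : p.enc (i + 1) κ t ≤ T) : p.flag src h i κ t ↔ p.flag src h' i κ t := by
  unfold flag
  rw [first_known_congr hT fun D' hD' => (enc_search_lt_stage hL hD').trans_le ht]
  refine or_congr_right <| exists_congr fun t' => and_congr_right fun ht' => hT _ ?_
  unfold enc at *
  omega

theorem alerted_congr (hL : 0 < p.L) {T i : ℕ} (hT : ∀ t < T, (h t ↔ h' t))
    (ht : p.enc (i + 1) p.B 0 ≤ T) : p.alerted src h i ↔ p.alerted src h' i := by
  refine exists_congr fun κ => and_congr_right fun hκ => flag_congr hL hT (le_trans ?_ ht)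
  have := Nat.mul_le_mul_right p.W (Nat.succ_le_of_lt hκ)
  simp only [enc, Nat.succ_mul, add_mul] at *
  omega

theorem window_congr (hL : 0 < p.L) {T i t : ℕ} (hT : ∀ t < T, (h t ↔ h' t))
    (ht : p.enc (i + 1) p.B t ≤ T) : p.window src h i ↔ p.window src h' i := by
  have key : ∀ i' ≤ i, (p.alerted src h i' ↔ p.alerted src h' i') := fun i' hi' => by
    refine alerted_congr hL hT (le_trans ?_ ht)
    have := Nat.mul_le_mul_right p.W (Nat.mul_le_mul_right (p.B + 1) (show i' + 1 ≤ i + 1 by omega))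
    simp only [enc, add_mul] at *
    omega
  unfold window
  refine and_congr (exists_congr fun i' => and_congr_right fun hi' => key i' hi')
    (forall₂_congr fun i' hi' => ?_)
  rw [key i' hi']

/-- Causality. It justifies stating the rules in terms of a whole history `h`, future steps
included. -/
theorem sends_congr (hL : 0 < p.L) (hW : 0 < p.W) {T : ℕ} (hT : ∀ t < T, (h t ↔ h' t)) :
    p.sends src ctr h T ↔ p.sends src ctr h' T := by
  obtain ⟨i, κ, t, hκ, ht, rfl⟩ := exists_enc_eq hW T
  rw [sends_enc hκ ht, sends_enc hκ ht]
  cases i with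
  | zero =>
    exact and_congr_right fun _ => first_reached_congr hT fun j' hj' =>
      enc_lt_enc hκ (by omega) (by omega)
  | succ i =>
    refine or_congr (and_congr_right fun _ => and_congr ?_ (flag_congr hL hT le_rfl)) ?_
    · refine first_reached_congr hT fun j' hj' => enc_lt_enc hκ ?_ (by omega)
      have := p.sweep_le ht.le
      unfold W
      omega
    · refine and_congr_right fun hB => and_congr_right fun htr => ?_
      subst hB
      exact first_known_congr hT fun D' hD' => enc_search_lt hL htr hD'

theorem listens_congr (hL : 0 < p.L) (hW : 0 < p.W) {T : ℕ} (hT : ∀ t < T, (h t ↔ h' t)) :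
    p.listens src ctr h T ↔ p.listens src ctr h' T := by
  obtain ⟨i, κ, t, hκ, ht, rfl⟩ := exists_enc_eq hW T
  rw [listens_enc hκ ht, listens_enc hκ ht]
  cases i with
  | zero => rfl
  | succ i =>
    refine or_congr (and_congr_right fun _ => ?_) ?_
    · refine first_reached_congr hT fun j' hj' => enc_lt_enc hκ ?_ (by omega)
      have := p.sweep_le (t := t + 1) ht
      unfold W
      omega
    · refine and_congr_right fun hB => and_congr_right fun htr => ?_
      subst hB
      exact window_congr hL hT le_rfl

end Params

/-! ### Correctness of executions without communication failures -/

namespace Params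

variable (p : Params) {V : Type*} (G : SimpleGraph V) (src : V → Prop) (ctr : V → ℕ → Prop)
  (h : V → ℕ → Prop)

/-- `h` is the family of histories of an execution without communication failures. -/
def IsRun : Prop :=
  ∀ T < p.steps, ∀ v, h v T ↔ ¬ p.sends (src v) (ctr v) (h v) T ∧
    p.listens (src v) (ctr v) (h v) T ∧ ∃ u, G.Adj v u ∧ p.sends (src u) (ctr u) (h u) T

/-- Around every vertex `x`, the ball of radius `r` is contained in a cluster of radius at most `H`
around a center of one of the sets of centers. -/
def Covered : Prop :=
  ∀ x, ∃ κ < p.B, ∃ z, ctr z κ ∧ ∀ y, G.dist x y ≤ p.r →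
    G.dist y z ≤ p.H ∧ ∀ z', ctr z' κ → G.dist y z ≤ G.dist y z'

variable {p G src ctr h}

theorem flag_mono {src : Prop} {h : ℕ → Prop} {i κ t t' : ℕ} (htt : t ≤ t')
    (hf : p.flag src h i κ t) : p.flag src h i κ t' :=
  hf.imp_right fun ⟨a, ha, hh⟩ => ⟨a, by omega, hh⟩

theorem IsRun.iff_at (hrun : p.IsRun G src ctr h) {i κ t : ℕ} (hi : i ≤ p.r) (hκ : κ ≤ p.B)
    (ht : t < p.W) (v : V) : h v (p.enc i κ t) ↔ ¬ p.sendsAt (src v) (ctr v) (h v) i κ t ∧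
      p.listensAt (src v) (ctr v) (h v) i κ t ∧
      ∃ u, G.Adj v u ∧ p.sendsAt (src u) (ctr u) (h u) i κ t := by
  rw [hrun _ (enc_lt_steps hi hκ ht)]
  simp only [sends_enc hκ ht, listens_enc hκ ht]

theorem first_reached_iff (hG : G.Connected) (hrun : p.IsRun G src ctr h) {κ : ℕ} (hκ : κ < p.B) :
    ∀ j ≤ p.W, ∀ v, First (p.reached (ctr v) (h v) κ) j ↔ Near G (fun z => ctr z κ) v j := by
  refine first_iff_near hG (fun v => Iff.rfl) ?_ ?_
  · intro j hj v hv
    obtain ⟨-, -, u, hadj, -, hu⟩ := (hrun.iff_at (Nat.zero_le _) hκ.le hj v).1 hv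
    exact ⟨u, hadj, hu⟩
  · intro j hj ih v hn
    obtain ⟨u, hadj, hu⟩ := hn.exists_adj hG
    refine (hrun.iff_at (Nat.zero_le _) hκ.le hj v).2 ⟨?_, hκ, u, hadj, hκ, (ih j le_rfl u).2 hu⟩
    rintro ⟨-, hv⟩
    have := hn.unique ((ih j le_rfl v).1 hv)
    omega

/-- An alert only reaches devices that are close to the devices that raised it. -/
theorem exists_dist_le_of_flag (hG : G.Connected) (hrun : p.IsRun G src ctr h) {i κ t : ℕ}
    (hi : i < p.r) (hκ : κ < p.B) (ht : t ≤ p.W) {v : V} (hv : p.flag (src v) (h v) i κ t) :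
    ∃ x, First (p.known (src x) (h x)) (i * p.r) ∧ G.dist v x ≤ t := by
  induction t using Nat.strong_induction_on generalizing v with
  | _ t ih =>
    rcases hv with hv | ⟨t', ht', hv⟩
    · exact ⟨v, hv, by simp⟩
    · obtain ⟨-, -, u, hadj, hu⟩ := (hrun.iff_at hi hκ.le (by omega) v).1 hv
      have hu' : p.flag (src u) (h u) i κ t' := by
        rcases hu with hu | hu
        · exact hu.2.2
        · omega
      obtain ⟨x, hx, hd⟩ := ih t' ht' (by omega) hu'
      have := dist_le_succ_of_adj hG hadj x
      exact ⟨x, hx, by omega⟩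

/-- One link in the chain of an alert. Consecutive sweep levels differ, so the receiver is not
itself sending. -/
theorem flag_succ (hrun : p.IsRun G src ctr h) {i κ t a b : ℕ} (hi : i < p.r) (hκ : κ < p.B)
    (ht : t < p.W) (ha : p.sweep t = a) (hb : p.sweep (t + 1) = b) (hab : a ≠ b) {u v : V}
    (hadj : G.Adj v u) (hfu : First (p.reached (ctr u) (h u) κ) a)
    (hfv : First (p.reached (ctr v) (h v) κ) b) (hu : p.flag (src u) (h u) i κ t) :
    p.flag (src v) (h v) i κ (t + 1) := by
  subst ha hb
  refine Or.inr ⟨t, by omega, (hrun.iff_at hi hκ.le ht v).2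
    ⟨?_, Or.inl ⟨hκ, hfv⟩, u, hadj, Or.inl ⟨hκ, hfu, hu⟩⟩⟩
  rintro (hs | hs)
  · exact hab (hs.2.1.unique hfv)
  · omega

/-- An alert reaches the nearest centers. -/
theorem flag_center (hG : G.Connected) (hrun : p.IsRun G src ctr h) {i κ : ℕ}
    (hi : i < p.r) (hκ : κ < p.B) {z : V} (hz : ctr z κ) : ∀ a ≤ p.H, ∀ v, G.dist v z = a →
      Near G (fun z => ctr z κ) v a → p.flag (src v) (h v) i κ (p.H - a) →
      p.flag (src z) (h z) i κ p.H := by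
  intro a
  induction a with
  | zero =>
    intro _ v hd _ hf
    rw [hG.dist_eq_zero_iff] at hd
    subst hd
    exact hf
  | succ a ih =>
    intro ha v hd hn hf
    obtain ⟨u, hadj, hu⟩ := exists_adj_dist_eq hG hd
    -- A center nearer to `u` than `z` would also be nearer to `v`; so geodesics to `z` stay in its
    -- cluster.
    have hnu : Near G (fun z => ctr z κ) u a := ⟨⟨z, hz, hu⟩, fun z' hz' => by
      have := hn.2 z' hz'
      have := dist_le_succ_of_adj hG hadj z'
      omega⟩
    have hW : p.W = 2 * p.H := rfl
    refine ih (by omega) u hu hnu ?_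
    have := flag_succ hrun hi hκ (t := p.H - (a + 1)) (a := a + 1) (b := a) (by omega)
      (by simp only [sweep]; omega) (by simp only [sweep]; omega) (by omega) hadj.symm
      ((first_reached_iff hG hrun hκ _ (by omega) v).2 hn)
      ((first_reached_iff hG hrun hκ _ (by omega) u).2 hnu) hf
    rwa [show p.H - (a + 1) + 1 = p.H - a by omega] at this

/-- The alert of a center reaches the devices to which it is nearest. -/
theorem flag_of_center (hG : G.Connected) (hrun : p.IsRun G src ctr h) {i κ : ℕ}
    (hi : i < p.r) (hκ : κ < p.B) {z : V} (hz : ctr z κ) (hf : p.flag (src z) (h z) i κ p.H) :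
    ∀ a ≤ p.H, ∀ v, G.dist v z = a → Near G (fun z => ctr z κ) v a →
      p.flag (src v) (h v) i κ (p.H + a) := by
  intro a
  induction a with
  | zero =>
    intro _ v hd _
    rw [hG.dist_eq_zero_iff] at hd
    subst hd
    exact hf
  | succ a ih =>
    intro ha v hd hn
    obtain ⟨u, hadj, hu⟩ := exists_adj_dist_eq hG hd
    have hnu : Near G (fun z => ctr z κ) u a := ⟨⟨z, hz, hu⟩, fun z' hz' => by
      have := hn.2 z' hz'
      have := dist_le_succ_of_adj hG hadj z'
      omega⟩
    have hW : p.W = 2 * p.H := rfl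
    exact flag_succ hrun hi hκ (t := p.H + a) (a := a) (b := a + 1) (by omega)
      (by simp only [sweep]; omega) (by simp only [sweep]; omega) (by omega) hadj
      ((first_reached_iff hG hrun hκ _ (by omega) u).2 hnu)
      ((first_reached_iff hG hrun hκ _ (by omega) v).2 hn) (ih (by omega) u hu hnu)

/-- The common center `z` of the ball around `x` is flagged by time `H`, and `y` by time `H + dist y
z ≤ 2 * H = W`. -/
theorem alerted_of_dist_le (hG : G.Connected) (hrun : p.IsRun G src ctr h)
    (hcov : p.Covered G ctr) {i : ℕ} (hi : i < p.r) {x y : V}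
    (hx : First (p.known (src x) (h x)) (i * p.r)) (hd : G.dist x y ≤ p.r) :
    p.alerted (src y) (h y) i := by
  obtain ⟨κ, hκ, z, hz, hball⟩ := hcov x
  obtain ⟨hxH, hxz⟩ := hball x (by simp)
  obtain ⟨hyH, hyz⟩ := hball y hd
  have hW : p.W = 2 * p.H := rfl
  refine ⟨κ, hκ, flag_mono ?_ <| flag_of_center hG hrun hi hκ hz
    (flag_center hG hrun hi hκ hz _ hxH x rfl ⟨⟨z, hz, rfl⟩, hxz⟩ (Or.inl hx))
    _ hyH y rfl ⟨⟨z, hz, rfl⟩, hyz⟩⟩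
  omega

/-- In an execution without communication failures, all devices learn their distances. -/
theorem first_known_iff (hG : G.Connected) (hL : 0 < p.L) {s : V}
    (hrun : p.IsRun G (· = s) ctr h) (hcov : p.Covered G ctr) :
    ∀ D ≤ p.r * p.r, ∀ v, First (p.known (v = s) (h v)) D ↔ G.dist v s = D := by
  simp only [← near_singleton]
  have hdec : ∀ D < p.r * p.r, D / p.r < p.r ∧ D % p.r < p.r ∧ D / p.r * p.r + D % p.r = D := by
    intro D hD
    have hr : 0 < p.r := Nat.pos_of_ne_zero fun h => by simp [h] at hD
    exact ⟨(Nat.div_lt_iff_lt_mul hr).2 hD, Nat.mod_lt _ hr, Nat.div_add_mod' D p.r⟩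
  refine first_iff_near hG (fun v => Iff.rfl) ?_ ?_
  · intro D hD v hv
    obtain ⟨h1, h2, h3⟩ := hdec D hD
    obtain ⟨-, -, u, hadj, hu⟩ :=
      (hrun.iff_at (i := D / p.r + 1) h1 le_rfl (h2.trans_le (r_le_W hL)) v).1 hv
    refine ⟨u, hadj, ?_⟩
    rcases hu with hu | ⟨-, -, hu⟩
    · exact (lt_irrefl _ hu.1).elim
    · rwa [h3] at hu
  · intro D hD ih v hn
    obtain ⟨h1, h2, h3⟩ := hdec D hD
    obtain ⟨u, hadj, hu⟩ := hn.exists_adj hG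
    refine (hrun.iff_at (i := D / p.r + 1) h1 le_rfl (h2.trans_le (r_le_W hL)) v).2
      ⟨?_, Or.inr ⟨rfl, h2, ?_, ?_⟩, u, hadj, Or.inr ⟨rfl, h2, ?_⟩⟩
    · rintro (hs | ⟨-, -, hs⟩)
      · exact lt_irrefl _ hs.1
      · rw [h3, ih D le_rfl] at hs
        have := hs.unique hn
        omega
    -- The point `x` where a geodesic from `v` to the source meets the starting level of the stage
    -- is within `r` of `v`, so its alert reaches `v` in this very stage.
    · obtain ⟨x, hx, hvx⟩ := exists_dist_eq_add hG (D / p.r * p.r) (D % p.r + 1) (u := v) (w := s)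
        (by rw [near_singleton.1 hn]; omega)
      refine ⟨_, le_rfl, alerted_of_dist_le hG hrun hcov h1 (x := x)
        ((ih _ (by omega) x).2 (near_singleton.2 hx)) ?_⟩
      rw [SimpleGraph.dist_comm]
      omega
    -- An alert in stage `i` comes from level `i * r` and travels at most `W = 4 * L * r`, so `D + 1
    -- ≤ (i + 4 * L) * r`: the window is still open.
    · rintro i hi ⟨κ, hκ, hf⟩
      obtain ⟨x, hx, hvx⟩ := exists_dist_le_of_flag hG hrun (by omega) hκ le_rfl hf
      have hmul := Nat.mul_le_mul_right p.r hi
      rw [ih _ (by omega), near_singleton] at hx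
      have htri := hG.dist_triangle (u := v) (v := x) (w := s)
      rw [near_singleton.1 hn, hx] at htri
      have hW : p.W = 4 * p.L * p.r := by simp only [W, H]; ring
      by_contra! hlt
      have := Nat.mul_le_mul_right p.r hlt.le
      rw [add_mul, ← hW] at this
      omega
    · rw [h3]
      exact (ih D le_rfl u).2 hu

end Params

theorem First.sInf_eq {g : ℕ → Prop} {j : ℕ} (hj : First g j) : sInf {i | g i} = j :=
  le_antisymm (Nat.sInf_le hj.1) (not_lt.1 fun hlt => hj.2 _ hlt (Nat.sInf_mem ⟨j, hj.1⟩))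

/-! ### Energy of a device, for arbitrary histories -/

namespace Params

variable {p : Params}

open Classical in
/-- Whatever a device hears, it is active in few steps only. -/
theorem card_active_le (hL : 0 < p.L) (src : Prop) (ctr h : ℕ → Prop) :
    ((Finset.range p.steps).filter fun T => p.sends src ctr h T ∨ p.listens src ctr h T).card ≤
      (p.B + 1) * p.W + p.r * p.B * 4 + ((4 * p.L + 1) * p.r + 1) := by
  -- These are the only values for which `First` can hold. If there is none, the default value 0
  -- merely enlarges the covering sets.
  set J : ℕ → ℕ := fun κ => sInf {j | p.reached ctr h κ j} with hJ
  set D₀ := sInf {D | p.known src h D} with hD₀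
  set i₀ := sInf {i | p.alerted src h i} with hi₀
  set S₁ : Finset ℕ := (Finset.range (p.B + 1) ×ˢ Finset.range p.W).image
    fun x => p.enc 0 x.1 x.2 with hS₁
  -- `|H - t| = J` has at most two solutions, for sending; shifted by one they are the listening
  -- steps.
  set S₂ : Finset ℕ := (Finset.range p.r ×ˢ Finset.range p.B).biUnion fun x =>
    ({p.H - J x.2, p.H + J x.2, p.H - J x.2 - 1, p.H + J x.2 - 1} : Finset ℕ).image
      (p.enc (x.1 + 1) x.2) with hS₂
  set S₃ : Finset ℕ := (Finset.Icc i₀ (i₀ + 4 * p.L) ×ˢ Finset.range p.r).image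
    fun x => p.enc (x.1 + 1) p.B x.2 with hS₃
  set S₄ : Finset ℕ := {p.enc (D₀ / p.r + 1) p.B (D₀ % p.r)} with hS₄
  have h₁ : S₁.card ≤ (p.B + 1) * p.W := by
    refine Finset.card_image_le.trans ?_
    simp
  have h₂ : S₂.card ≤ p.r * p.B * 4 := by
    refine (Finset.card_biUnion_le_card_mul _ _ 4 fun x _ =>
      Finset.card_image_le.trans Finset.card_le_four).trans ?_
    simp
  have h₃ : S₃.card ≤ (4 * p.L + 1) * p.r := by
    refine Finset.card_image_le.trans ?_
    rw [Finset.card_product, Nat.card_Icc, Finset.card_range]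
    exact Nat.mul_le_mul_right _ (by omega)
  have h₄ : S₄.card = 1 := Finset.card_singleton _
  have hsub : ((Finset.range p.steps).filter fun T =>
      p.sends src ctr h T ∨ p.listens src ctr h T) ⊆ S₁ ∪ S₂ ∪ (S₃ ∪ S₄) := by
    intro T hT
    rw [Finset.mem_filter, Finset.mem_range] at hT
    obtain ⟨hT, hact⟩ := hT
    have hW : 0 < p.W := Nat.pos_of_ne_zero fun h => by simp [steps, h] at hT
    obtain ⟨i, κ, t, hκ, ht, rfl⟩ := exists_enc_eq hW T
    rw [sends_enc hκ ht, listens_enc hκ ht] at hact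
    have hi : i < p.r + 1 := by
      by_contra! hle
      have h1 := Nat.mul_le_mul_right p.W (Nat.mul_le_mul_right (p.B + 1) hle)
      simp only [enc, steps, add_mul] at hT h1
      omega
    cases i with
    | zero =>
      refine Finset.mem_union_left _ (Finset.mem_union_left _ ?_)
      exact Finset.mem_image.2 ⟨(κ, t), by simp; omega, rfl⟩
    | succ i =>
      rcases hact with (⟨hκB, hf, -⟩ | ⟨rfl, htr, hf⟩) | (⟨hκB, hf⟩ | ⟨rfl, htr, hw⟩)
      · refine Finset.mem_union_left _ (Finset.mem_union_right _ ?_)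
        refine Finset.mem_biUnion.2 ⟨(i, κ), by simp; omega, Finset.mem_image.2 ⟨t, ?_, rfl⟩⟩
        have hJt : J κ = p.sweep t := hf.sInf_eq
        simp only [Finset.mem_insert, Finset.mem_singleton, hJt, sweep]
        omega
      · refine Finset.mem_union_right _ (Finset.mem_union_right _ ?_)
        have hD : D₀ = i * p.r + t := hf.sInf_eq
        rw [hS₄, Finset.mem_singleton, hD, Nat.mul_add_div_of_lt htr, Nat.mul_add_mod_of_lt htr]
      · refine Finset.mem_union_left _ (Finset.mem_union_right _ ?_)
        refine Finset.mem_biUnion.2 ⟨(i, κ), by simp; omega, Finset.mem_image.2 ⟨t, ?_, rfl⟩⟩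
        have hJt : J κ = p.sweep (t + 1) := hf.sInf_eq
        simp only [Finset.mem_insert, Finset.mem_singleton, hJt, sweep]
        omega
      · refine Finset.mem_union_right _ (Finset.mem_union_left _ ?_)
        obtain ⟨⟨i', hi', ha⟩, hw⟩ := hw
        have hi₀i : i₀ ≤ i' := Nat.sInf_le ha
        have := hw i₀ (hi₀i.trans hi') (Nat.sInf_mem (s := {i | p.alerted src h i}) ⟨i', ha⟩)
        exact Finset.mem_image.2 ⟨(i, t), by simp; omega, rfl⟩
  refine (Finset.card_le_card hsub).trans ((Finset.card_union_le _ _).trans ?_)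
  have := Finset.card_union_le S₁ S₂
  have := Finset.card_union_le S₃ S₄
  omega

end Params

namespace Params

/-! ### The protocol

A step is carried out in `B` rounds. In each of these rounds the devices that send in this step
transmit with one of `L` probabilities. -/

variable (p : Params)

/-- The random experiments of a device: one for each set of centers, one for each round. -/
abbrev Trial : Type := Fin p.B ⊕ Fin (p.steps * p.B)

/-- The random bits of a device for one experiment. -/
abbrev Bits : Type := Fin (p.L + 1) → Bool

variable {p} in
/-- An experiment of probability `2 ^ (-(j + 2))`. -/
def Hit (j : ℕ) (x : p.Bits) : Prop := ∀ b, b.val < j + 2 → x b = true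

-- As `B = L * Q`, the residue `κ % L` takes each of the `L` rates exactly `Q` times.
variable {p} in
def center (F : p.Trial → p.Bits) (κ : ℕ) : Prop :=
  ∃ hκ : κ < p.B, Hit (κ % p.L) (F (.inl ⟨κ, hκ⟩))

variable {p} in
def transmits (F : p.Trial → p.Bits) (ρ : ℕ) : Prop :=
  ∃ hρ : ρ < p.steps * p.B, Hit (ρ % p.L) (F (.inr ⟨ρ, hρ⟩))

/-- The device received a message in one of the rounds of step `T`, if it received messages in the
rounds of the set `R`. -/
def heard (R : Set ℕ) (T : ℕ) : Prop := ∃ b < p.B, T * p.B + b ∈ R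

open Classical in
/-- The action of a device in round `ρ`, if it received messages in the rounds of the set `R`. -/
noncomputable def roundAction (src : Prop) (F : p.Trial → p.Bits) (R : Set ℕ) (ρ : ℕ) : Action :=
  if p.sends src (center F) (p.heard R) (ρ / p.B) then
    if transmits F ρ then .send 0 else .idle
  else if p.listens src (center F) (p.heard R) (ρ / p.B) then .listen else .idle

/-- The random bits of a device, sorted by experiments. -/
noncomputable def sorted (x : Fin (Fintype.card (p.Trial × Fin (p.L + 1))) → Bool) :
    p.Trial → p.Bits :=
  fun τ b => x (Fintype.equivFin _ (τ, b))

/-- The state of a device records whether the device is the source, its random bits and the set of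
rounds in which it received a message. -/
@[reducible] noncomputable def protocol : Protocol where
  rounds := p.steps * p.B
  coins := Fintype.card (p.Trial × Fin (p.L + 1))
  State := Bool × (p.Trial → p.Bits) × Set ℕ
  init b x := (b, p.sorted x, ∅)
  act ρ q := p.roundAction (q.1 = true) q.2.1 q.2.2 ρ
  step ρ q f := (q.1, q.2.1, if f.isSome then insert ρ q.2.2 else q.2.2)
  output q := sInf {D | p.known (q.1 = true) (p.heard q.2.2) D}

variable {p} {V : Type*} {G : SimpleGraph V}

theorem isSome_feedback_iff {a : V → Action} {v : V} : (feedback G a v).isSome ↔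
    a v = .listen ∧ ∃! u, G.Adj v u ∧ (a u).payload.isSome := by
  unfold feedback
  split_ifs with h1 h2
  · simpa [h1, h2] using h2.choose_spec.1.2
  · simp [h2]
  · simp [h1]

theorem roundAction_eq_listen_iff {src : Prop} {F : p.Trial → p.Bits} {R : Set ℕ} {ρ : ℕ} :
    p.roundAction src F R ρ = .listen ↔ ¬ p.sends src (center F) (p.heard R) (ρ / p.B) ∧
      p.listens src (center F) (p.heard R) (ρ / p.B) := by
  unfold roundAction
  split_ifs <;> simp_all

theorem isSome_payload_roundAction_iff {src : Prop} {F : p.Trial → p.Bits} {R : Set ℕ} {ρ : ℕ} :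
    (p.roundAction src F R ρ).payload.isSome ↔
      p.sends src (center F) (p.heard R) (ρ / p.B) ∧ transmits F ρ := by
  unfold roundAction
  split_ifs <;> simp_all [Action.payload]

theorem div_B_lt {T b : ℕ} (hb : b < p.B) : (T * p.B + b) / p.B = T :=
  Nat.mul_add_div_of_lt hb

theorem heard_congr {R R' : Set ℕ} {ρ T : ℕ} (hR : ∀ t < ρ, (t ∈ R ↔ t ∈ R'))
    (hT : (T + 1) * p.B ≤ ρ) : p.heard R T ↔ p.heard R' T := by
  refine exists_congr fun b => and_congr_right fun hb => hR _ ?_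
  rw [Nat.succ_mul] at hT
  omega

-- This allows the receptions so far to be replaced by the set of all receptions, so that one fixed
-- set per device describes the execution.
open Classical in
theorem roundAction_congr (hL : 0 < p.L) (hW : 0 < p.W) {src : Prop} {F : p.Trial → p.Bits}
    {R R' : Set ℕ} {ρ : ℕ} (hR : ∀ t < ρ, (t ∈ R ↔ t ∈ R')) :
    p.roundAction src F R ρ = p.roundAction src F R' ρ := by
  have h : ∀ T < ρ / p.B, (p.heard R T ↔ p.heard R' T) := fun T hT =>
    heard_congr hR (((Nat.mul_le_mul_right _ hT).trans (Nat.div_mul_le_self _ _)))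
  exact if_congr (sends_congr hL hW h) rfl (if_congr (listens_congr hL hW h) rfl rfl)

open Classical in
theorem card_roundAction_ne_idle_le (hL : 0 < p.L) (src : Prop) (F : p.Trial → p.Bits)
    (R : Set ℕ) {R' : ℕ → Set ℕ} (hW : 0 < p.W)
    (hR : ∀ ρ, ∀ t < ρ, (t ∈ R' ρ ↔ t ∈ R)) :
    ((Finset.range (p.steps * p.B)).filter fun ρ =>
      p.roundAction src F (R' ρ) ρ ≠ .idle).card ≤
      ((p.B + 1) * p.W + p.r * p.B * 4 + ((4 * p.L + 1) * p.r + 1)) * p.B := by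
  set S := (Finset.range p.steps).filter fun T => p.sends src (center F) (p.heard R) T ∨
    p.listens src (center F) (p.heard R) T with hS
  have hsub : ((Finset.range (p.steps * p.B)).filter fun ρ =>
      p.roundAction src F (R' ρ) ρ ≠ .idle) ⊆
      (S ×ˢ Finset.range p.B).image fun x => x.1 * p.B + x.2 := by
    intro ρ hρ
    rw [Finset.mem_filter, Finset.mem_range, roundAction_congr hL hW (hR ρ)] at hρ
    obtain ⟨hρ, hne⟩ := hρ
    have hB : 0 < p.B := Nat.pos_of_ne_zero fun h => by simp [h] at hρ
    refine Finset.mem_image.2 ⟨(ρ / p.B, ρ % p.B), ?_, Nat.div_add_mod' _ _⟩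
    rw [Finset.mem_product, Finset.mem_range, hS, Finset.mem_filter, Finset.mem_range]
    refine ⟨⟨(Nat.div_lt_iff_lt_mul hB).2 hρ, ?_⟩, Nat.mod_lt _ hB⟩
    by_contra! hno
    exact hne (by simp [roundAction, hno.1, hno.2])
  refine (Finset.card_le_card hsub).trans (Finset.card_image_le.trans ?_)
  rw [Finset.card_product, Finset.card_range]
  exact Nat.mul_le_mul_right _ (card_active_le hL _ _ _)

/-! #### Executions -/

variable [DecidableEq V] {s : V} {ω : V → Fin p.protocol.coins → Bool}

/-- The rounds in which the device `v` receives a message. -/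
def receptions (G : SimpleGraph V) (s : V) (ω : V → Fin p.protocol.coins → Bool) (v : V) : Set ℕ :=
  {ρ | (feedback G (p.protocol.action G s ω ρ) v).isSome}

theorem state_eq (ρ : ℕ) (v : V) : p.protocol.state G s ω ρ v =
    (decide (v = s), p.sorted (ω v), {t | t < ρ ∧ t ∈ receptions G s ω v}) := by
  induction ρ with
  | zero => simp [Protocol.state, protocol]
  | succ ρ ih =>
    have hfb : (feedback G (fun u => p.protocol.act ρ (p.protocol.state G s ω ρ u)) v).isSome ↔
        ρ ∈ receptions G s ω v := Iff.rfl
    change ((p.protocol.state G s ω ρ v).1, (p.protocol.state G s ω ρ v).2.1,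
      if _ then _ else (p.protocol.state G s ω ρ v).2.2) = _
    rw [ih]
    refine Prod.ext rfl (Prod.ext rfl ?_)
    ext t
    dsimp only
    split_ifs with hf
    · have := hfb.1 hf
      simp only [Set.mem_insert_iff, Set.mem_ofPred_eq]
      constructor
      · rintro (rfl | ⟨h1, h2⟩)
        · exact ⟨by omega, this⟩
        · exact ⟨by omega, h2⟩
      · rintro ⟨h1, h2⟩
        rcases Nat.lt_succ_iff_lt_or_eq.1 h1 with h | h
        · exact Or.inr ⟨h, h2⟩
        · exact Or.inl h
    · have := mt hfb.2 hf
      simp only [Set.mem_ofPred_eq]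
      constructor
      · rintro ⟨h1, h2⟩
        exact ⟨by omega, h2⟩
      · rintro ⟨h1, h2⟩
        rcases Nat.lt_succ_iff_lt_or_eq.1 h1 with h | h
        · exact ⟨h, h2⟩
        · subst h
          exact (this h2).elim

theorem action_eq (ρ : ℕ) (v : V) : p.protocol.action G s ω ρ v =
    p.roundAction (v = s) (p.sorted (ω v)) {t | t < ρ ∧ t ∈ receptions G s ω v} ρ := by
  rw [Protocol.action, state_eq]
  simp

theorem deviceEnergy_le (hL : 0 < p.L) (hW : 0 < p.W) (v : V) :
    p.protocol.deviceEnergy G s ω v ≤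
      ((p.B + 1) * p.W + p.r * p.B * 4 + ((4 * p.L + 1) * p.r + 1)) * p.B := by
  unfold Protocol.deviceEnergy
  simp only [action_eq]
  convert card_roundAction_ne_idle_le hL (v = s) (p.sorted (ω v)) (receptions G s ω v) hW
    (R' := fun ρ => {t | t < ρ ∧ t ∈ receptions G s ω v}) fun ρ t ht => by simp [ht] using 1

theorem mem_receptions_iff (hL : 0 < p.L) (hW : 0 < p.W) {T b : ℕ} (hb : b < p.B) (v : V) :
    T * p.B + b ∈ receptions G s ω v ↔
      ¬ p.sends (v = s) (center (p.sorted (ω v))) (p.heard (receptions G s ω v)) T ∧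
      p.listens (v = s) (center (p.sorted (ω v))) (p.heard (receptions G s ω v)) T ∧
      ∃! u, G.Adj v u ∧
        p.sends (u = s) (center (p.sorted (ω u))) (p.heard (receptions G s ω u)) T ∧
        transmits (p.sorted (ω u)) (T * p.B + b) := by
  have h : ∀ u, p.protocol.action G s ω (T * p.B + b) u =
      p.roundAction (u = s) (p.sorted (ω u)) (receptions G s ω u) (T * p.B + b) := fun u => by
    rw [action_eq]
    refine roundAction_congr hL hW fun t ht => ?_
    simp [ht]
  have hmem : T * p.B + b ∈ receptions G s ω v ↔
    (feedback G (p.protocol.action G s ω (T * p.B + b)) v).isSome := Iff.rfl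
  rw [hmem, isSome_feedback_iff]
  simp only [h, roundAction_eq_listen_iff, isSome_payload_roundAction_iff, div_B_lt hb, and_assoc]

end Params

namespace Params

/-! #### Executions without communication failures -/

variable (p : Params) {V : Type*} (G : SimpleGraph V) (src : V → Prop) (ctr : V → ℕ → Prop)

/-- The histories of the devices before step `T`, if there are no communication failures. -/
def idealBefore : ℕ → V → ℕ → Prop
  | 0 => fun _ _ => False
  | T + 1 => fun v T' => idealBefore T v T' ∨ (T' = T ∧
      ¬ p.sends (src v) (ctr v) (idealBefore T v) T ∧
      p.listens (src v) (ctr v) (idealBefore T v) T ∧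
      ∃ u, G.Adj v u ∧ p.sends (src u) (ctr u) (idealBefore T u) T)

/-- The histories of the devices, if there are no communication failures. -/
def ideal (v : V) (T : ℕ) : Prop :=
  p.idealBefore G src ctr (T + 1) v T

variable {p G src ctr}

theorem idealBefore_iff {T T' : ℕ} {v : V} :
    p.idealBefore G src ctr T v T' ↔ T' < T ∧ p.ideal G src ctr v T' := by
  induction T with
  | zero => simp [idealBefore]
  | succ T ih =>
    have hsucc : p.idealBefore G src ctr (T + 1) v T' ↔
      p.idealBefore G src ctr T v T' ∨ (T' = T ∧ _) := Iff.rfl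
    rcases lt_trichotomy T' T with h | rfl | h
    · rw [hsucc, ih]
      constructor
      · rintro (⟨h1, h2⟩ | h1)
        · exact ⟨by omega, h2⟩
        · omega
      · exact fun h1 => Or.inl ⟨h, h1.2⟩
    · simp [ideal]
    · rw [hsucc, ih]
      omega

/-- By causality, the histories cut off at `T` may be replaced by the complete ones. -/
theorem ideal_iff (hL : 0 < p.L) (hW : 0 < p.W) (T : ℕ) (v : V) : p.ideal G src ctr v T ↔
    ¬ p.sends (src v) (ctr v) (p.ideal G src ctr v) T ∧
    p.listens (src v) (ctr v) (p.ideal G src ctr v) T ∧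
    ∃ u, G.Adj v u ∧ p.sends (src u) (ctr u) (p.ideal G src ctr u) T := by
  have h : ∀ u, ∀ t < T, (p.idealBefore G src ctr T u t ↔ p.ideal G src ctr u t) :=
    fun u t ht => by simp [idealBefore_iff, ht]
  have hnot : ¬ p.idealBefore G src ctr T v T := by simp [idealBefore_iff]
  conv_lhs => rw [ideal, idealBefore]
  simp only [hnot, false_or, true_and]
  rw [sends_congr hL hW (h v), listens_congr hL hW (h v)]
  simp only [fun u => sends_congr (src := src u) (ctr := ctr u) hL hW (h u)]

variable (p G src) in
/-- With the random bits `F`, there are no communication failures: whenever a neighbour of `v`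
sends in a step, in some round of this step exactly one of the sending neighbours transmits. -/
def NoFailure (F : V → p.Trial → p.Bits) : Prop :=
  ∀ T < p.steps, ∀ v,
    (∃ u, G.Adj v u ∧ p.sends (src u) (center (F u))
      (p.ideal G src (fun u => center (F u)) u) T) →
    ∃ b < p.B, ∃! u, (G.Adj v u ∧ p.sends (src u) (center (F u))
      (p.ideal G src (fun u => center (F u)) u) T) ∧ transmits (F u) (T * p.B + b)

variable [DecidableEq V] {s : V} {ω : V → Fin p.protocol.coins → Bool}

/-- Equal histories before `T` give the same senders and listeners in step `T`, and a round that
isolates one sender delivers its signal. -/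
theorem heard_receptions_iff (hL : 0 < p.L) (hW : 0 < p.W)
    (hF : p.NoFailure G (· = s) fun v => p.sorted (ω v)) :
    ∀ T < p.steps, ∀ v, p.heard (receptions G s ω v) T ↔
      p.ideal G (· = s) (fun v => center (p.sorted (ω v))) v T := by
  intro T
  induction T using Nat.strong_induction_on with
  | _ T ih =>
    intro hT v
    have h : ∀ u, ∀ t < T, (p.heard (receptions G s ω u) t ↔
        p.ideal G (· = s) (fun v => center (p.sorted (ω v))) u t) :=
      fun u t ht => ih t ht (by omega) u
    have hs := fun u => sends_congr (src := u = s) (ctr := center (p.sorted (ω u))) hL hW (h u)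
    have hl := fun u => listens_congr (src := u = s) (ctr := center (p.sorted (ω u))) hL hW (h u)
    have hmem : ∀ b < p.B, (T * p.B + b ∈ receptions G s ω v ↔ _) :=
      fun b hb => mem_receptions_iff hL hW hb v
    simp only [hs, hl] at hmem
    rw [ideal_iff hL hW]
    constructor
    · rintro ⟨b, hb, hr⟩
      obtain ⟨h1, h2, u, ⟨hadj, hu, -⟩, -⟩ := (hmem b hb).1 hr
      exact ⟨h1, h2, u, hadj, hu⟩
    · rintro ⟨h1, h2, h3⟩
      obtain ⟨b, hb, h4⟩ := hF T hT v h3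
      simp only [and_assoc] at h4
      exact ⟨b, hb, (hmem b hb).2 ⟨h1, h2, h4⟩⟩

/-- Without communication failures, the protocol is correct. -/
theorem result_eq (hG : G.Connected) (hL : 0 < p.L) (hW : 0 < p.W)
    (hcov : p.Covered G fun v => center (p.sorted (ω v)))
    (hF : p.NoFailure G (· = s) fun v => p.sorted (ω v)) {v : V} (hv : G.dist v s ≤ p.r * p.r) :
    p.protocol.result G s ω v = G.dist v s := by
  have hrun : p.IsRun G (· = s) (fun v => center (p.sorted (ω v)))
      (p.ideal G (· = s) fun v => center (p.sorted (ω v))) :=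
    fun T _ v => ideal_iff hL hW T v
  have hfirst := (first_known_iff hG hL hrun hcov _ hv v).2 rfl
  have h : ∀ T < p.steps,
      (p.heard {t | t < p.protocol.rounds ∧ t ∈ receptions G s ω v} T ↔
        p.ideal G (· = s) (fun v => center (p.sorted (ω v))) v T) := by
    intro T hT
    rw [← heard_receptions_iff hL hW hF T hT v]
    refine heard_congr (ρ := p.steps * p.B) (fun t ht => ?_) (Nat.mul_le_mul_right _ hT)
    simp [ht]
  have hr : ∀ D' < G.dist v s, p.enc (D' / p.r + 1) p.B (D' % p.r) < p.steps := by
    intro D' hD'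
    have hr : 0 < p.r := Nat.pos_of_ne_zero fun h => by rw [h] at hv; omega
    exact enc_lt_steps ((Nat.div_lt_iff_lt_mul hr).2 (by omega)) le_rfl
      ((Nat.mod_lt _ hr).trans_le (r_le_W hL))
  rw [← first_known_congr h hr] at hfirst
  rw [Protocol.result, state_eq]
  simpa using hfirst.sInf_eq

end Params

/-! ### Uniform probability on finite types -/

open Classical in
/-- The probability of the event `s` for a uniformly random element. -/
noncomputable def prob {α : Type*} [Fintype α] (s : Set α) : ℝ :=
  (Finset.univ.filter (· ∈ s)).card / Fintype.card α

section Prob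

variable {α β : Type*} [Fintype α] [Fintype β]

theorem prob_nonneg (s : Set α) : 0 ≤ prob s := by
  unfold prob
  positivity

theorem prob_mono {s t : Set α} (h : s ⊆ t) : prob s ≤ prob t := by
  unfold prob
  gcongr

theorem prob_univ [Nonempty α] : prob (Set.univ : Set α) = 1 := by
  simp [prob]

theorem prob_compl [Nonempty α] (s : Set α) : prob sᶜ = 1 - prob s := by
  classical
  unfold prob
  rw [eq_sub_iff_add_eq, ← add_div, ← Nat.cast_add, div_eq_one_iff_eq (by simp)]
  have := Finset.card_filter_add_card_filter_not (s := (Finset.univ : Finset α)) (· ∈ s)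
  simp only [Set.mem_compl_iff]
  rw [← Finset.card_univ, ← this, add_comm]

theorem prob_union_le (s t : Set α) : prob (s ∪ t) ≤ prob s + prob t := by
  classical
  unfold prob
  rw [← add_div, ← Nat.cast_add]
  gcongr
  simp only [Set.mem_union, Finset.filter_or]
  exact Finset.card_union_le _ _

theorem prob_iUnion_le {ι : Type*} (I : Finset ι) (s : ι → Set α) {ε : ℝ}
    (h : ∀ i ∈ I, prob (s i) ≤ ε) : prob (⋃ i ∈ I, s i) ≤ I.card * ε := by
  classical
  induction I using Finset.induction_on with
  | empty => simp [prob]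
  | insert i I hi ih =>
    rw [Finset.set_biUnion_insert, Finset.card_insert_of_notMem hi]
    push_cast
    have h1 := prob_union_le (s i) (⋃ j ∈ I, s j)
    have h2 := h i (Finset.mem_insert_self _ _)
    have h3 := ih fun j hj => h j (Finset.mem_insert_of_mem hj)
    linarith

theorem prob_iUnion_of_disjoint {ι : Type*} (I : Finset ι) (s : ι → Set α)
    (h : ∀ i ∈ I, ∀ j ∈ I, i ≠ j → Disjoint (s i) (s j)) :
    prob (⋃ i ∈ I, s i) = ∑ i ∈ I, prob (s i) := by
  classical
  unfold prob
  rw [← Finset.sum_div, ← Nat.cast_sum, ← Finset.card_biUnion]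
  · congr 3
    ext x
    simp
  · intro i hi j hj hij
    refine Finset.disjoint_filter.2 ?_
    exact fun x _ hx hx' => Set.disjoint_left.1 (h i hi j hj hij) hx hx'

theorem prob_preimage_equiv (e : α ≃ β) (s : Set β) : prob (e ⁻¹' s) = prob s := by
  classical
  unfold prob
  rw [Fintype.card_congr e]
  congr 2
  exact Finset.card_equiv e (by simp)

theorem prob_pi {ι : Type*} [Fintype ι] [DecidableEq ι] {α : ι → Type*} [∀ i, Fintype (α i)]
    (s : ∀ i, Set (α i)) : prob (Set.univ.pi s) = ∏ i, prob (s i) := by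
  classical
  unfold prob
  rw [Finset.prod_div_distrib, Fintype.card_pi, ← Nat.cast_prod, ← Nat.cast_prod,
    ← Fintype.card_piFinset]
  congr 3
  ext x
  simp [Set.mem_pi]

/-- Conditioning on the first component; it separates the coins for centers from those for
transmissions. -/
theorem prob_prod_le {s : Set (α × β)} {ε : ℝ} [Nonempty α]
    (h : ∀ a, prob {b | (a, b) ∈ s} ≤ ε) : prob s ≤ ε := by
  classical
  rcases isEmpty_or_nonempty β with hβ | hβ
  · obtain ⟨a⟩ := ‹Nonempty α›
    have h1 : prob s = 0 := by simp [prob]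
    rw [h1]
    exact (prob_nonneg _).trans (h a)
  · have hcard : ((Finset.univ.filter (· ∈ s)).card : ℝ) =
        ∑ a, ((Finset.univ.filter fun b => (a, b) ∈ s).card : ℝ) := by
      rw [← Nat.cast_sum, Finset.card_filter, Fintype.sum_prod_type]
      simp_rw [Finset.card_filter]
    have hα : (0 : ℝ) < Fintype.card α := by exact_mod_cast Fintype.card_pos
    have hβ : (0 : ℝ) < Fintype.card β := by exact_mod_cast Fintype.card_pos
    unfold prob at h ⊢
    rw [div_le_iff₀ (by rw [Fintype.card_prod]; positivity), hcard, Fintype.card_prod]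
    calc _ ≤ ∑ _a : α, ε * (Fintype.card β : ℝ) := by
          refine Finset.sum_le_sum fun a _ => ?_
          have := h a
          rwa [div_le_iff₀ hβ] at this
      _ = _ := by
          simp
          ring

/-- Independent repetitions. -/
theorem prob_forall_le_pow {ι : Type*} [Fintype ι] [DecidableEq ι] [Nonempty α] {Q : ℕ}
    {τ : Fin Q → ι} (hτ : Function.Injective τ) {s : Set α} {ε : ℝ} (h : prob s ≤ ε) :
    prob {F : ι → α | ∀ q, F (τ q) ∈ s} ≤ ε ^ Q := by
  classical
  have heq : {F : ι → α | ∀ q, F (τ q) ∈ s} =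
      Set.univ.pi fun i => if i ∈ Finset.univ.image τ then s else Set.univ := by
    ext F
    simp only [Set.mem_ofPred_eq, Set.mem_pi, Set.mem_univ, true_imp_iff, Finset.mem_image,
      Finset.mem_univ, true_and]
    constructor
    · intro hF i
      split_ifs with hi
      · obtain ⟨q, rfl⟩ := hi
        exact hF q
      · trivial
    · intro hF q
      have := hF (τ q)
      rwa [if_pos ⟨q, rfl⟩] at this
  rw [heq, prob_pi]
  have : ∀ i, prob (if i ∈ Finset.univ.image τ then s else Set.univ) =
      if i ∈ Finset.univ.image τ then prob s else 1 := fun i => by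
    split_ifs
    · rfl
    · exact prob_univ
  simp_rw [this]
  rw [Finset.prod_ite_mem, Finset.univ_inter, Finset.prod_const,
    Finset.card_image_of_injective _ hτ, Finset.card_fin]
  exact pow_le_pow_left₀ (prob_nonneg _) h _

/-- If the devices of a set `B` transmit independently with a probability of about `1 / |B|`, then
with constant probability exactly one of them does, and it lies in a given large part `A`. -/
theorem le_prob_exists_unique {V : Type*} [Fintype V] [DecidableEq V] [Nonempty α]
    {A B : Finset V} (hAB : A ⊆ B) (hcard : B.card ≤ 2 * A.card) {s : Set α}
    (hlo : 1 ≤ 4 * B.card * prob s) (hhi : 2 * B.card * prob s ≤ 1) :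
    1 / 16 ≤ prob {x : V → α | ∃ u ∈ A, x u ∈ s ∧ ∀ w ∈ B, w ≠ u → x w ∉ s} := by
  classical
  set E : V → Set (V → α) := fun u =>
    Set.univ.pi fun w => if w = u then s else if w ∈ B then sᶜ else Set.univ with hE
  have hmem : ∀ u ∈ A, ∀ x, x ∈ E u ↔ x u ∈ s ∧ ∀ w ∈ B, w ≠ u → x w ∉ s := by
    intro u hu x
    simp only [hE, Set.mem_pi, Set.mem_univ, true_imp_iff]
    constructor
    · intro h
      refine ⟨by simpa using h u, fun w hw hne => ?_⟩
      simpa [hw, hne] using h w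
    · rintro ⟨h1, h2⟩ w
      split_ifs with hw hwB
      · exact hw ▸ h1
      · exact h2 w hwB hw
      · trivial
  have heq : {x : V → α | ∃ u ∈ A, x u ∈ s ∧ ∀ w ∈ B, w ≠ u → x w ∉ s} = ⋃ u ∈ A, E u := by
    ext x
    simp only [Set.mem_ofPred_eq, Set.mem_iUnion, exists_prop]
    exact exists_congr fun u => and_congr_right fun hu => (hmem u hu x).symm
  rw [heq, prob_iUnion_of_disjoint]
  swap
  · intro u hu w hw hne
    rw [Set.disjoint_left]
    intro x hx hx'
    rw [hmem u hu] at hx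
    rw [hmem w hw] at hx'
    exact hx.2 w (hAB hw) hne.symm hx'.1
  set q := prob s with hq
  have hq0 : 0 ≤ q := prob_nonneg _
  have hone : ∀ u ∈ A, q * (1 - B.card * q) ≤ prob (E u) := by
    intro u hu
    have hprob : ∀ w, prob (if w = u then s else if w ∈ B then sᶜ else Set.univ) =
        if w = u then q else if w ∈ B then 1 - q else 1 := fun w => by
      split_ifs
      · rfl
      · exact prob_compl _
      · exact prob_univ
    rw [hE, prob_pi, Finset.prod_congr rfl fun w _ => hprob w,
      ← Finset.mul_prod_erase _ _ (Finset.mem_univ u), if_pos rfl]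
    refine mul_le_mul_of_nonneg_left ?_ hq0
    have hB : (1 : ℝ) ≤ B.card := by
      exact_mod_cast Finset.card_pos.2 ⟨u, hAB hu⟩
    have h1 : ∏ w ∈ Finset.univ.erase u, (if w = u then q else if w ∈ B then 1 - q else 1) =
        (1 - q) ^ (B.erase u).card := by
      rw [Finset.prod_congr rfl (g := fun w => if w ∈ B.erase u then 1 - q else 1)
        fun w hw => by simp [Finset.ne_of_mem_erase hw]]
      rw [Finset.prod_ite_mem, Finset.prod_const]
      congr 2
      ext w
      simp
    rw [h1]
    -- Bernoulli's inequality: all others fail with probability at least `1 - |B| q ≥ 1/2`. Summing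
    -- the disjoint events over `A`, where `|A| q ≥ 1/8`, gives 1/16.
    have h2 := one_add_mul_le_pow (a := -q) (by nlinarith) (B.erase u).card
    have h3 : ((B.erase u).card : ℝ) ≤ B.card := by
      exact_mod_cast Finset.card_le_card (Finset.erase_subset _ _)
    calc 1 - B.card * q ≤ 1 + (B.erase u).card * -q := by nlinarith
      _ ≤ _ := h2
  have h2 : (B.card : ℝ) ≤ 2 * A.card := by exact_mod_cast hcard
  calc (1 : ℝ) / 16 ≤ A.card * (q * (1 - B.card * q)) := by
        have h3 : 1 / 8 ≤ A.card * q := by nlinarith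
        nlinarith
    _ = ∑ _u ∈ A, q * (1 - B.card * q) := by simp
    _ ≤ _ := Finset.sum_le_sum hone

theorem law_real_eq_prob (P : Protocol) (V : Type*) [Fintype V] [DecidableEq V]
    (s : Set (V → Fin P.coins → Bool)) : (P.law V).real s = prob s := by
  classical
  have hB : ∀ b : Bool, (PMF.uniformOfFintype Bool).toMeasure {b} = 2⁻¹ := fun b => by
    rw [PMF.toMeasure_apply_singleton _ _ (measurableSet_singleton _)]
    simp
  have hsing : ∀ x, P.law V {x} = (Fintype.card (V → Fin P.coins → Bool) : ENNReal)⁻¹ := by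
    intro x
    simp only [Protocol.law, Measure.pi_singleton, hB]
    simp [← ENNReal.inv_pow]
  have hfin : P.law V s = ∑ x ∈ Finset.univ.filter (· ∈ s), P.law V {x} := by
    rw [sum_measure_singleton]
    congr
    simp
  rw [Measure.real, hfin, Finset.sum_congr rfl fun x _ => hsing x]
  simp [prob, div_eq_mul_inv]

end Prob

namespace Params

/-! ### The failure probability -/

variable {p : Params} {V : Type*} [Fintype V]

theorem prob_hit {j : ℕ} (hj : j < p.L) : prob {x : p.Bits | Hit j x} = (1 / 2) ^ (j + 2) := by
  classical
  have heq : {x : p.Bits | Hit j x} =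
      Set.univ.pi fun b => if b.val < j + 2 then {true} else Set.univ := by
    ext x
    simp only [Hit, Set.mem_ofPred_eq, Set.mem_pi, Set.mem_univ, true_imp_iff]
    refine forall_congr' fun b => ?_
    split_ifs with hb <;> simp [hb]
  have hprob : ∀ b : Fin (p.L + 1),
      prob (if b.val < j + 2 then ({true} : Set Bool) else Set.univ) =
        if b.val < j + 2 then 1 / 2 else 1 := fun b => by
    split_ifs
    · simp [prob, Finset.filter_eq']
    · exact prob_univ
  rw [heq, prob_pi, Finset.prod_congr rfl fun b _ => hprob b, Finset.prod_ite,
    Finset.prod_const, Finset.prod_const_one, mul_one, Fin.card_filter_val_lt]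
  congr 1
  omega

/-- Exactly one device of `B` has success in its experiment, and it belongs to `A`. -/
def Unique (A B : Finset V) (j : ℕ) (x : V → p.Bits) : Prop :=
  ∃ u ∈ A, Hit j (x u) ∧ ∀ w ∈ B, w ≠ u → ¬ Hit j (x w)

/-- Some ball around `x` contains at least half of the next larger ball. -/
theorem exists_ball_growth_le (G : SimpleGraph V) (hn : Fintype.card V < 2 ^ p.L) (R : ℕ) (x : V) :
    ∃ i < p.L, (Finset.univ.filter fun y => G.dist x y ≤ (i + 1) * R).card ≤
      2 * (Finset.univ.filter fun y => G.dist x y ≤ i * R).card := by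
  by_contra! hno
  -- If the volume doubled at every scale, the last ball would have at least `2 ^ L > n` points.
  have hpow : ∀ i ≤ p.L, 2 ^ i ≤ (Finset.univ.filter fun y => G.dist x y ≤ i * R).card := by
    intro i
    induction i with
    | zero =>
      intro _
      exact Finset.card_pos.2 ⟨x, by simp⟩
    | succ i ih =>
      intro hi
      have h1 := hno i (by omega)
      have h2 := ih (by omega)
      rw [pow_succ]
      omega
  exact absurd ((hpow _ le_rfl).trans (Finset.card_filter_le _ _))
    (not_le.2 (by rwa [Finset.card_univ]))

theorem log_card_lt (hn : Fintype.card V < 2 ^ p.L) {B : Finset V} (hB : B.Nonempty) :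
    Nat.log 2 B.card < p.L :=
  (Nat.log_lt_iff_lt_pow (by norm_num) (Finset.card_pos.2 hB).ne').2
    ((Finset.card_le_univ B).trans_lt hn)

theorem mul_add_lt_B {q j : ℕ} (hq : q < p.Q) (hj : j < p.L) : q * p.L + j < p.B := by
  have := Nat.mul_le_mul_right p.L (Nat.succ_le_of_lt hq)
  rw [Nat.succ_mul, mul_comm p.Q] at this
  unfold B
  omega

variable [DecidableEq V]

/-- For `j = Nat.log 2 |B|` the rate `2 ^ (-(j + 2))` lies between `1 / (4 |B|)` and `1 / (2 |B|)`,
which is why `Hit` uses `j + 2` bits. -/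
theorem prob_forall_not_unique_le {A B : Finset V} (hAB : A ⊆ B) (hcard : B.card ≤ 2 * A.card)
    (hB : B.Nonempty) (hj : Nat.log 2 B.card < p.L) {ι : Type*} [Fintype ι] [DecidableEq ι]
    {Q : ℕ} {τ : Fin Q → ι} (hτ : Function.Injective τ) :
    prob {F : ι → V → p.Bits | ∀ q, ¬ Unique A B (Nat.log 2 B.card) (F (τ q))} ≤
      (15 / 16 : ℝ) ^ Q := by
  refine prob_forall_le_pow hτ (s := {x | Unique A B (Nat.log 2 B.card) x}ᶜ) ?_
  have hpos : B.card ≠ 0 := (Finset.card_pos.2 hB).ne'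
  have h1 : ((2 ^ Nat.log 2 B.card : ℕ) : ℝ) ≤ B.card := by
    exact_mod_cast Nat.pow_log_le_self 2 hpos
  have h2 : (B.card : ℝ) ≤ ((2 ^ (Nat.log 2 B.card + 1) : ℕ) : ℝ) := by
    exact_mod_cast (Nat.lt_pow_succ_log_self (by norm_num) _).le
  push_cast at h1 h2
  have hp : (0 : ℝ) < 2 ^ Nat.log 2 B.card := by positivity
  rw [prob_compl]
  have := le_prob_exists_unique (α := p.Bits) hAB hcard
    (s := {x | Hit (Nat.log 2 B.card) x}) ?_ ?_
  · change 1 / 16 ≤ prob {x | Unique A B (Nat.log 2 B.card) x} at this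
    linarith
  · rw [prob_hit hj, pow_add, one_div_pow]
    field_simp
    nlinarith
  · rw [prob_hit hj, pow_add, one_div_pow]
    field_simp
    rw [pow_succ] at h2
    nlinarith

/-- With high probability, the clusters cover all small balls. -/
theorem prob_not_covered_le {G : SimpleGraph V} (hG : G.Connected)
    (hn : Fintype.card V < 2 ^ p.L)
    (b : Fin (p.steps * p.B) → V → p.Bits) :
    prob {a : Fin p.B → V → p.Bits |
      ¬ p.Covered G fun v => center fun τ : p.Trial => Sum.elim (a · v) (b · v) τ} ≤
      Fintype.card V * (15 / 16 : ℝ) ^ p.Q := by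
  -- The gap `2 * r` pays for moving from `x` to `y` twice: a center in `A` is within `i * 2r + r`
  -- of `y`, and one outside `B` is farther away than that.
  choose i hi hgrowth using exists_ball_growth_le (p := p) G hn (2 * p.r)
  set A : V → Finset V := fun x => Finset.univ.filter fun y => G.dist x y ≤ i x * (2 * p.r) with hA
  set B : V → Finset V := fun x =>
    Finset.univ.filter fun y => G.dist x y ≤ (i x + 1) * (2 * p.r) with hBdef
  have hB : ∀ x, (B x).Nonempty := fun x => ⟨x, by simp [hBdef]⟩
  have hAB : ∀ x, A x ⊆ B x := fun x y hy => by
    simp only [hA, hBdef, Finset.mem_filter, Finset.mem_univ, true_and, add_mul] at hy ⊢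
    omega
  have hj : ∀ x, Nat.log 2 (B x).card < p.L := fun x => log_card_lt hn (hB x)
  set τ : V → Fin p.Q → Fin p.B := fun x q =>
    ⟨q * p.L + Nat.log 2 (B x).card, mul_add_lt_B q.2 (hj x)⟩ with hτdef
  have hτ : ∀ x, Function.Injective (τ x) := fun x q q' hqq => by
    simp only [hτdef, Fin.mk.injEq, add_left_inj] at hqq
    exact Fin.ext (Nat.eq_of_mul_eq_mul_right ((Nat.zero_le _).trans_lt (hj x)) hqq)
  refine (prob_mono ?_).trans (prob_iUnion_le Finset.univ (fun x => {a : Fin p.B → V → p.Bits |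
    ∀ q, ¬ Unique (A x) (B x) (Nat.log 2 (B x).card) (a (τ x q))}) fun x _ =>
      prob_forall_not_unique_le (hAB x) (hgrowth x) (hB x) (hj x) (hτ x))
  intro a ha
  simp only [Finset.mem_univ, Set.iUnion_true, Set.mem_iUnion, Set.mem_ofPred_eq] at ha ⊢
  by_contra! hall
  refine ha fun x => ?_
  obtain ⟨q, z, hz, hzh, hzu⟩ := hall x
  have hmod : (τ x q).val % p.L = Nat.log 2 (B x).card := Nat.mul_add_mod_of_lt (hj x)
  refine ⟨τ x q, (τ x q).2, z, ⟨(τ x q).2, by rw [hmod]; exact hzh⟩, fun y hy => ?_⟩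
  have hzA : G.dist x z ≤ i x * (2 * p.r) := by simpa [hA] using hz
  have hyz : G.dist y z ≤ p.r + i x * (2 * p.r) := by
    have := hG.dist_triangle (u := y) (v := x) (w := z)
    rw [SimpleGraph.dist_comm (u := y) (v := x)] at this
    omega
  refine ⟨?_, fun z' ⟨_, hz'⟩ => ?_⟩
  · have := Nat.mul_le_mul_right (2 * p.r) (Nat.succ_le_of_lt (hi x))
    rw [Nat.succ_mul, mul_comm p.L] at this
    unfold H
    omega
  · rw [hmod] at hz'
    by_cases hne : z' = z
    · rw [hne]
    · have hzB : ¬ z' ∈ B x := fun hzB => hzu z' hzB hne hz'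
      simp only [hBdef, Finset.mem_filter, Finset.mem_univ, true_and, add_mul] at hzB
      have := hG.dist_triangle (u := x) (v := y) (w := z')
      omega

/-- With high probability, there are no communication failures. -/
theorem prob_failure_le (G : SimpleGraph V) (src : V → Prop) (hn : Fintype.card V < 2 ^ p.L)
    (a : Fin p.B → V → p.Bits) :
    prob {b : Fin (p.steps * p.B) → V → p.Bits |
      ¬ p.NoFailure G src fun v τ => Sum.elim (a · v) (b · v) τ} ≤
      p.steps * Fintype.card V * (15 / 16 : ℝ) ^ p.Q := by
  classical
  -- With `a` fixed, the centers, the ideal histories and the sets `N` of sending neighbours do not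
  -- depend on `b`, so the transmission coins are still independent of them.
  set ctr : V → ℕ → Prop := fun v κ =>
    ∃ hκ : κ < p.B, Hit (κ % p.L) (a ⟨κ, hκ⟩ v) with hctr
  set N : ℕ × V → Finset V := fun x => Finset.univ.filter fun u =>
    G.Adj x.2 u ∧ p.sends (src u) (ctr u) (p.ideal G src ctr u) x.1 with hN
  set I : Finset (ℕ × V) := (Finset.range p.steps ×ˢ Finset.univ).filter fun x =>
    (N x).Nonempty with hI
  have hj : ∀ x ∈ I, Nat.log 2 (N x).card < p.L := fun x hx =>
    log_card_lt hn (Finset.mem_filter.1 hx).2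
  set τ : ℕ × V → Fin p.Q → ℕ := fun x q => x.1 * p.B + (q * p.L + Nat.log 2 (N x).card) with hτ
  have hlt : ∀ x ∈ I, ∀ q, τ x q < p.steps * p.B := fun x hx q => by
    have h1 := mul_add_lt_B q.2 (hj x hx)
    have h2 := Finset.mem_range.1 (Finset.mem_product.1 (Finset.mem_filter.1 hx).1).1
    have := Nat.mul_le_mul_right p.B (Nat.succ_le_of_lt h2)
    rw [Nat.succ_mul] at this
    simp only [hτ]
    omega
  have hIcard : (I.card : ℝ) ≤ p.steps * Fintype.card V := by
    have := Finset.card_filter_le (Finset.range p.steps ×ˢ (Finset.univ : Finset V))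
      fun x => (N x).Nonempty
    rw [Finset.card_product, Finset.card_range, Finset.card_univ] at this
    exact_mod_cast this
  refine (prob_mono ?_).trans ((prob_iUnion_le I
    (fun x => {b : Fin (p.steps * p.B) → V → p.Bits |
      ∃ hx : x ∈ I, ∀ q, ¬ Unique (N x) (N x) (Nat.log 2 (N x).card) (b ⟨τ x q, hlt x hx q⟩)})
    (ε := (15 / 16) ^ p.Q) fun x hx => ?_).trans
    (mul_le_mul_of_nonneg_right hIcard (by positivity)))
  · intro b hb
    simp only [Set.mem_iUnion, Set.mem_ofPred_eq, exists_prop] at hb ⊢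
    by_contra! hall
    refine hb fun T hT v hne => ?_
    obtain ⟨u₀, hu₀⟩ := hne
    have hx : (T, v) ∈ I := Finset.mem_filter.2
      ⟨Finset.mem_product.2 ⟨Finset.mem_range.2 hT, Finset.mem_univ _⟩,
        ⟨u₀, Finset.mem_filter.2 ⟨Finset.mem_univ _, hu₀⟩⟩⟩
    obtain ⟨q, u, hu, huh, huu⟩ := hall _ hx hx
    have hmod : τ (T, v) q % p.L = Nat.log 2 (N (T, v)).card := by
      simp only [hτ]
      -- `B` is a multiple of `L`, so every step starts the cycle of rates afresh.
      rw [show T * p.B + (q * p.L + Nat.log 2 (N (T, v)).card) =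
        (T * p.Q + q) * p.L + Nat.log 2 (N (T, v)).card by unfold B; ring]
      exact Nat.mul_add_mod_of_lt (hj _ hx)
    refine ⟨q * p.L + Nat.log 2 (N (T, v)).card, mul_add_lt_B q.2 (hj _ hx), u,
      ⟨(Finset.mem_filter.1 hu).2, hlt _ hx q, ?_⟩, ?_⟩
    · change Hit (τ (T, v) q % p.L) _
      rw [hmod]
      exact huh
    · rintro w ⟨hw, _, hwh⟩
      by_contra hwu
      change Hit (τ (T, v) q % p.L) _ at hwh
      rw [hmod] at hwh
      exact huu w (Finset.mem_filter.2 ⟨Finset.mem_univ _, hw⟩) hwu hwh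
  · have hinj : Function.Injective fun q => (⟨τ x q, hlt x hx q⟩ : Fin (p.steps * p.B)) :=
      fun q q' hqq => by
        simp only [hτ, Fin.mk.injEq, add_right_inj, add_left_inj] at hqq
        exact Fin.ext (Nat.eq_of_mul_eq_mul_right ((Nat.zero_le _).trans_lt (hj x hx)) hqq)
    refine (prob_mono fun b hb => ?_).trans (prob_forall_not_unique_le (Finset.Subset.refl (N x))
      (by omega) (Finset.mem_filter.1 hx).2 (hj x hx) hinj)
    obtain ⟨_, hb⟩ := hb
    exact hb

/-- The random bits of all devices, sorted by experiments. -/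
noncomputable def sortEquiv (p : Params) (V : Type*) : (V → Fin p.protocol.coins → Bool) ≃
    (Fin p.B → V → p.Bits) × (Fin (p.steps * p.B) → V → p.Bits) where
  toFun ω := (fun i v => p.sorted (ω v) (.inl i), fun i v => p.sorted (ω v) (.inr i))
  invFun x v k :=
    let y := (Fintype.equivFin (p.Trial × Fin (p.L + 1))).symm k
    Sum.elim (x.1 · v) (x.2 · v) y.1 y.2
  left_inv ω := by
    funext v k
    obtain ⟨⟨τ, b⟩, rfl⟩ := (Fintype.equivFin (p.Trial × Fin (p.L + 1))).surjective k
    cases τ <;> simp [sorted]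
  right_inv x := by
    refine Prod.ext ?_ ?_ <;> · funext i v b; simp [sorted]

theorem prob_wrong_le {G : SimpleGraph V} (hG : G.Connected) (hn : Fintype.card V < 2 ^ p.L)
    (hL : 0 < p.L) (hW : 0 < p.W) (s : V) (hr : Fintype.card V ≤ p.r * p.r) :
    prob {ω | ¬ ∀ v, p.protocol.result G s ω v = G.dist v s} ≤
      (p.steps + 1) * Fintype.card V * (15 / 16 : ℝ) ^ p.Q := by
  have hsort : ∀ ω : V → Fin p.protocol.coins → Bool, ∀ v, (fun τ : p.Trial =>
      Sum.elim ((p.sortEquiv V ω).1 · v) ((p.sortEquiv V ω).2 · v) τ) = p.sorted (ω v) :=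
    fun ω v => by funext τ; cases τ <;> rfl
  set S₁ : Set ((Fin p.B → V → p.Bits) × (Fin (p.steps * p.B) → V → p.Bits)) :=
    {x | ¬ p.Covered G fun v => center fun τ : p.Trial => Sum.elim (x.1 · v) (x.2 · v) τ} with hS₁
  set S₂ : Set ((Fin p.B → V → p.Bits) × (Fin (p.steps * p.B) → V → p.Bits)) :=
    {x | ¬ p.NoFailure G (· = s) fun v τ => Sum.elim (x.1 · v) (x.2 · v) τ} with hS₂
  have h₁ : prob S₁ ≤ Fintype.card V * (15 / 16 : ℝ) ^ p.Q := by
    rw [← prob_preimage_equiv (Equiv.prodComm _ _)]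
    exact prob_prod_le fun b => prob_not_covered_le hG hn b
  have h₂ : prob S₂ ≤ p.steps * Fintype.card V * (15 / 16 : ℝ) ^ p.Q :=
    prob_prod_le fun a => prob_failure_le G (· = s) hn a
  have hsub : {ω | ¬ ∀ v, p.protocol.result G s ω v = G.dist v s} ⊆
      p.sortEquiv V ⁻¹' (S₁ ∪ S₂) := by
    intro ω hω
    by_contra hno
    simp only [Set.mem_preimage, Set.mem_union, not_or, hS₁, hS₂, Set.mem_ofPred_eq,
      not_not, hsort] at hno
    refine hω fun v => result_eq hG hL hW hno.1 hno.2 ?_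
    -- A shortest path has fewer than `n ≤ r * r` edges, so the `r` stages of `r` levels exhaust the
    -- graph.
    obtain ⟨w, hw, hlen⟩ := hG.exists_path_of_dist v s
    rw [← hlen]
    exact hw.length_lt.le.trans hr
  refine (prob_mono hsub).trans ?_
  rw [prob_preimage_equiv]
  refine (prob_union_le _ _).trans ?_
  linarith

end Params

/-! ### The choice of the parameters -/

/-- The parameters for networks with `n` devices. -/
def params (K n : ℕ) : Params where
  L := Nat.log 2 n + 1
  Q := 22 * K * (Nat.log 2 n + 1)
  r := Nat.sqrt n + 1

namespace Params

theorem params_error_le {c n : ℕ} (hn : 1 ≤ n) :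
    (((params (c + 14) n).steps : ℝ) + 1) * n * (15 / 16 : ℝ) ^ (params (c + 14) n).Q ≤
      1 / (n : ℝ) ^ c := by
  set K := c + 14 with hK
  set L := Nat.log 2 n + 1 with hL
  set N := 2 ^ L with hN
  have hnN : n < N := Nat.lt_pow_succ_log_self (by norm_num) n
  have hLN : L ≤ N := Nat.lt_two_pow_self.le
  have hrN : Nat.sqrt n + 1 ≤ N := by
    have := Nat.sqrt_le_self n
    omega
  have hN2 : 2 ≤ N := by omega
  have hK1 : 1 ≤ K := by omega
  have hsteps : (params K n).steps + 1 ≤ 185 * K * N ^ 5 := by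
    change (Nat.sqrt n + 1 + 1) * (L * (22 * K * L) + 1) * (2 * (2 * (Nat.sqrt n + 1) * L)) + 1 ≤ _
    have h1 : Nat.sqrt n + 1 + 1 ≤ 2 * N := by omega
    have h2 : L * (22 * K * L) + 1 ≤ 23 * K * N ^ 2 := by
      have : L * L ≤ N * N := Nat.mul_le_mul hLN hLN
      nlinarith
    have h3 : 2 * (2 * (Nat.sqrt n + 1) * L) ≤ 4 * N ^ 2 := by
      have := Nat.mul_le_mul hrN hLN
      nlinarith
    have h4 : 1 ≤ K * N ^ 5 := Nat.one_le_iff_ne_zero.2 (by positivity)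
    calc _ ≤ 2 * N * (23 * K * N ^ 2) * (4 * N ^ 2) + K * N ^ 5 :=
          add_le_add (Nat.mul_le_mul (Nat.mul_le_mul h1 h2) h3) h4
      _ = _ := by ring
  -- The exponents add up to `8 + K + 5 + 1 + c = 2 * K`, whence `K = c + 14`.
  have hpow : 185 * K * N ^ 5 * n * n ^ c ≤ N ^ (2 * K) := by
    have h1 : 185 ≤ N ^ 8 := le_trans (by norm_num) (Nat.pow_le_pow_left hN2 8)
    have h2 : K ≤ N ^ K := Nat.lt_two_pow_self.le.trans (Nat.pow_le_pow_left hN2 K)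
    calc _ ≤ N ^ 8 * N ^ K * N ^ 5 * N * N ^ c := by gcongr
      _ = _ := by rw [hK]; ring
  have hQ : (15 / 16 : ℝ) ^ (params K n).Q ≤ 1 / (N : ℝ) ^ (2 * K) := by
    change (15 / 16 : ℝ) ^ (22 * K * L) ≤ _
    rw [mul_assoc, pow_mul]
    -- The factor 22 in `Q` is chosen so that `(15/16) ^ 22 ≤ 1/4`.
    calc ((15 / 16 : ℝ) ^ 22) ^ (K * L) ≤ (1 / 4) ^ (K * L) :=
          pow_le_pow_left₀ (by positivity) (by norm_num) _
      _ = _ := by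
        rw [hN, show (1 / 4 : ℝ) = (1 / 2) ^ 2 by norm_num, ← pow_mul]
        push_cast
        rw [← pow_mul, one_div_pow]
        ring_nf
  have hn0 : (0 : ℝ) < (n : ℝ) ^ c := by positivity
  have hN0 : (0 : ℝ) < (N : ℝ) ^ (2 * K) := by positivity
  calc _ ≤ (185 * K * N ^ 5 : ℝ) * n * (1 / (N : ℝ) ^ (2 * K)) := by
        gcongr
        exact_mod_cast hsteps
    _ ≤ _ := by
        rw [mul_one_div, div_le_div_iff₀ hN0 hn0, one_mul]
        exact_mod_cast hpow

theorem params_bounds (K : ℕ) {n : ℕ} (hn : 1 ≤ n) :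
    (((params K n).r : ℝ) ≤ 2 * √n ∧ 1 ≤ √(n : ℝ)) ∧
      (1 ≤ ((params K n).L : ℝ) ∧ ((params K n).L : ℝ) ≤ 2 * (1 + Real.log n)) := by
  have hn' : (1 : ℝ) ≤ n := by exact_mod_cast hn
  have hs : 1 ≤ √(n : ℝ) := Real.one_le_sqrt.2 hn'
  refine ⟨⟨?_, hs⟩, ?_, ?_⟩
  · have := Real.nat_sqrt_le_real_sqrt (a := n)
    simp only [params]
    push_cast
    linarith
  · simp [params]
  · have h1 : (Nat.log 2 n : ℝ) ≤ Real.logb 2 n := by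
      exact_mod_cast Real.natLog_le_logb n 2
    have h2 : Real.logb 2 n ≤ 2 * Real.log n := by
      rw [Real.logb, div_le_iff₀ (Real.log_pos (by norm_num))]
      nlinarith [Real.log_two_gt_d9, Real.log_nonneg hn']
    simp only [params]
    push_cast
    linarith

theorem params_B (K n : ℕ) :
    ((params K n).B : ℝ) = 22 * K * ((params K n).L : ℝ) ^ 2 := by
  simp only [params, B]
  push_cast
  ring

theorem params_W (K n : ℕ) :
    ((params K n).W : ℝ) = 4 * (params K n).r * (params K n).L := by
  simp only [params, W, H]
  push_cast
  ring

theorem params_rounds_le {K n : ℕ} (hK : 1 ≤ K) (hn : 1 ≤ n) :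
    ((params K n).protocol.rounds : ℝ) ≤
      (400000 * K ^ 2) * (n : ℝ) ^ (3 / 2 : ℝ) * (1 + Real.log n) ^ 5 := by
  obtain ⟨⟨hr, hs⟩, hL, hLle⟩ := params_bounds K hn
  have hK' : (1 : ℝ) ≤ K := by exact_mod_cast hK
  have hB := params_B K n
  have hW := params_W K n
  set L := ((params K n).L : ℝ)
  set r := ((params K n).r : ℝ)
  have hround : ((params K n).protocol.rounds : ℝ) =
      (r + 1) * ((params K n).B + 1) * (params K n).W * (params K n).B := by
    simp only [steps]
    push_cast
    rfl
  -- The number of rounds is in fact Õ(n); the stated exponent leaves room.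
  have hn' : (n : ℝ) ≤ (n : ℝ) ^ (3 / 2 : ℝ) :=
    Real.self_le_rpow_of_one_le (by exact_mod_cast hn) (by norm_num)
  have hr0 : 0 ≤ r := Nat.cast_nonneg _
  have h1 : 22 * (K : ℝ) * L ^ 2 + 1 ≤ 23 * K * L ^ 2 := by nlinarith [one_le_pow₀ hL (n := 2)]
  rw [hround, hB, hW]
  calc _ ≤ (3 * √n) * (23 * K * L ^ 2) * (4 * (2 * √n) * L) * (22 * K * L ^ 2) := by
        gcongr
        linarith
    _ = 12144 * K ^ 2 * (√n * √n) * L ^ 5 := by ring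
    _ ≤ 12144 * K ^ 2 * (n : ℝ) ^ (3 / 2 : ℝ) * (2 * (1 + Real.log n)) ^ 5 := by
        rw [Real.mul_self_sqrt (Nat.cast_nonneg _)]
        gcongr
    _ = 388608 * (K ^ 2 * (n : ℝ) ^ (3 / 2 : ℝ) * (1 + Real.log n) ^ 5) := by ring
    _ ≤ 400000 * (K ^ 2 * (n : ℝ) ^ (3 / 2 : ℝ) * (1 + Real.log n) ^ 5) := by
        have : 0 ≤ 1 + Real.log n := by linarith
        gcongr
        norm_num
    _ = _ := by ring

theorem params_energy_le {K n : ℕ} (hK : 1 ≤ K) (hn : 1 ≤ n) {E : ℕ}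
    (hE : E ≤ (((params K n).B + 1) * (params K n).W + (params K n).r * (params K n).B * 4 +
      ((4 * (params K n).L + 1) * (params K n).r + 1)) * (params K n).B) :
    (E : ℝ) ≤ (400000 * K ^ 2) * √n * (1 + Real.log n) ^ 5 := by
  obtain ⟨⟨hr, hs⟩, hL, hLle⟩ := params_bounds K hn
  have hK' : (1 : ℝ) ≤ K := by exact_mod_cast hK
  have hB := params_B K n
  have hW := params_W K n
  have hE' := (Nat.cast_le (α := ℝ)).2 hE
  push_cast at hE'
  rw [hB, hW] at hE'
  set L := ((params K n).L : ℝ)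
  set r := ((params K n).r : ℝ)
  have hr0 : 0 ≤ r := Nat.cast_nonneg _
  have h1 : 22 * (K : ℝ) * L ^ 2 + 1 ≤ 23 * K * L ^ 2 := by nlinarith [one_le_pow₀ hL (n := 2)]
  have hL2 : L ^ 2 ≤ L ^ 3 := pow_le_pow_right₀ hL (by norm_num)
  have hL1 : L ≤ L ^ 3 := le_self_pow₀ hL (by norm_num)
  have hKL : L ^ 3 ≤ K * L ^ 3 := le_mul_of_one_le_left (by positivity) hK'
  have hKs : 1 ≤ K * L ^ 3 := one_le_mul_of_one_le_of_one_le hK' (one_le_pow₀ hL)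
  calc (E : ℝ) ≤ _ := hE'
    _ ≤ ((23 * K * L ^ 2) * (4 * (2 * √n) * L) + 2 * √n * (22 * K * L ^ 3) * 4 +
          ((5 * (K * L ^ 3)) * (2 * √n) + √n * (K * L ^ 3))) * (22 * K * L ^ 2) := by
        gcongr
        · linarith
        · exact one_le_mul_of_one_le_of_one_le hs hKs
    _ = 8162 * K ^ 2 * √n * L ^ 5 := by ring
    _ ≤ 8162 * K ^ 2 * √n * (2 * (1 + Real.log n)) ^ 5 := by gcongr
    _ = 261184 * (K ^ 2 * √n * (1 + Real.log n) ^ 5) := by ring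
    _ ≤ 400000 * (K ^ 2 * √n * (1 + Real.log n) ^ 5) := by
        have : 0 ≤ 1 + Real.log n := by linarith
        gcongr
        norm_num
    _ = _ := by ring

end Params
end RadioNetwork

theorem mainTheorem1 :
    ∃ k : ℕ, ∀ c : ℕ, ∃ (C : ℝ) (A : ℕ → ℕ → RadioNetwork.Protocol),
      ∀ (V : Type*) [Fintype V] [DecidableEq V] (G : SimpleGraph V) [DecidableRel G.Adj],
        G.Connected → ∀ s : V,
          -- running time
          ((A (Fintype.card V) G.maxDegree).rounds : ℝ) ≤
              C * (Fintype.card V : ℝ) ^ (3 / 2 : ℝ) * (1 + Real.log (Fintype.card V)) ^ k ∧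
          -- energy, in every execution
          (∀ ω, ((A (Fintype.card V) G.maxDegree).energy G s ω : ℝ) ≤
              C * Real.sqrt (Fintype.card V) * (1 + Real.log (Fintype.card V)) ^ k) ∧
          -- correctness with high probability
          1 - 1 / (Fintype.card V : ℝ) ^ c ≤
            ((A (Fintype.card V) G.maxDegree).law V).real
              {ω | ∀ v, (A (Fintype.card V) G.maxDegree).result G s ω v = G.dist v s} := by
  open RadioNetwork RadioNetwork.Params in
  -- The power 5 comes from `B * W * B`: each `B` contributes `L ^ 2` and `W` contributes `L`. The
  -- maximum degree is not used by the algorithm.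
  refine ⟨5, fun c => ⟨400000 * ((c + 14 : ℕ) : ℝ) ^ 2,
    fun n _ => (params (c + 14) n).protocol, ?_⟩⟩
  intro V _ _ G _ hG s
  have hn : 1 ≤ Fintype.card V := Fintype.card_pos_iff.2 ⟨s⟩
  set n := Fintype.card V with hndef
  have hL : 0 < (params (c + 14) n).L := Nat.succ_pos _
  have hW : 0 < (params (c + 14) n).W :=
    Nat.mul_pos two_pos (Nat.mul_pos (Nat.mul_pos two_pos (Nat.succ_pos _)) hL)
  refine ⟨params_rounds_le (by omega) hn, fun ω => params_energy_le (by omega) hn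
    (Finset.sup_le fun v _ => deviceEnergy_le hL hW v), ?_⟩
  have hwrong := prob_wrong_le (p := params (c + 14) n) hG
    (Nat.lt_pow_succ_log_self (by norm_num) _) hL hW s (Nat.lt_succ_sqrt n).le
  have herr := params_error_le (c := c) hn
  rw [law_real_eq_prob]
  have hcompl := prob_compl {ω | ∀ v, (params (c + 14) n).protocol.result G s ω v = G.dist v s}
  change prob {ω | ¬ ∀ v, (params (c + 14) n).protocol.result G s ω v = G.dist v s} = _ at hcompl
  linarith
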